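/- Let $N\ge 1$, let $\Omega\subset\mathbb R^N$ be a bounded open set, $T>0$, $Q_T=\Omega\times(0,T)$, and for a function $\gamma$ on $\Omega$ let $\mathbb K_\gamma=\{v\in H_0^1(\Omega): |\nabla v|\le \gamma \text{ a.e. in } \Omega\}$. Consider data $(\mathbf b,c,f,g,u_0)$ such that, for some $l\in\mathbb R$ and $m>0$, $$\mathbf b\in L^2(Q_T;\mathbb R^N),\quad c,f\in L^2(Q_T),\quad c-\tfrac12\nabla\cdot\mathbf b\ge l \text{ in the sense of distributions in } Q_T,$$ $$g\in W^{1,\infty}(0,T;L^\infty(\Omega)),\quad g\ge m \text{ a.e. in } Q_T,\quad u_0\in\mathbb K_{g(0)},$$ where $g\in W^{1,\infty}(0,T;L^\infty(\Omega))$ means $g,\partial_t g\in L^\infty(Q_T)$, and $g$ is identified with its representative in $C([0,T];L^\infty(\Omega))$. A solution for these data is a function $u\in L^\infty(0,T;W_0^{1,\infty}(\Omega))\cap C(\overline{Q_T})$ with $\partial_t u\in L^2(Q_T)$, $u(0)=u_0$, $u(t)\in\mathbb K_{g(t)}$ for a.e. $t\in(0,T)$, and, for a.e. $t\in(0,T)$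 and all $v\in\mathbb K_{g(t)}$, $$\int_\Omega \partial_t u(t)(v-u(t))+\int_\Omega \mathbf b(t)\cdot\nabla u(t)(v-u(t))+\int_\Omega c(t)u(t)(v-u(t))\ \ge\ \int_\Omega f(t)(v-u(t)).$$ **Theorem 3.2.** Given $\Omega$, $T$, $l\in\mathbb R$, $m>0$ and $M\ge0$, there is a constant $C>0$, depending only on these, with the following property. If, for $i=1,2$, the data $(\mathbf b_i,c_i,f_i,g_i,u_{0i})$ satisfy the above assumptions with these $l$ and $m$, if the norms of $\mathbf b_i,c_i,f_i$ in $L^2(Q_T)$ and of $g_i,\partial_t g_i$ in $L^\infty(Q_T)$ are at most $M$, and if $u_i$ is a solution for these data, then $$\|u_1-u_2\|^2_{L^\infty(0,T;L^2(\Omega))}\le C\Big(\|u_{01}-u_{02}\|^2_{L^2(\Omega)}+\|\mathbf b_1-\mathbf b_2\|_{L^1(Q_T)}+\|c_1-c_2\|_{L^1(Q_T)}+\|f_1-f_2\|_{L^1(Q_T)}+\|g_1-g_2\|_{L^\infty(Q_T)}\Big).$$ -/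

import Mathlib

open MeasureTheory Set Filter Topology
open scoped ENNReal NNReal ContDiff

noncomputable section

namespace GradVI

/-- The space `ℝ^N` with its Euclidean norm. -/
abbrev Space (N : ℕ) : Type := EuclideanSpace ℝ (Fin N)

/-- The space-time cylinder `Q_T = Ω × (0, T)`. -/
def cyl {N : ℕ} (Ω : Set (Space N)) (T : ℝ) : Set (Space N × ℝ) := Ω ×ˢ Ioo 0 T

/-- Lebesgue measure on `Ω`. -/
def muSpace {N : ℕ} (Ω : Set (Space N)) : Measure (Space N) := volume.restrict Ω

/-- Lebesgue measure on the time interval `(0, T)`. -/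
def muTime (T : ℝ) : Measure ℝ := volume.restrict (Ioo 0 T)

/-- Lebesgue measure on `Q_T`. -/
def muCyl {N : ℕ} (Ω : Set (Space N)) (T : ℝ) : Measure (Space N × ℝ) :=
  volume.restrict (cyl Ω T)

/-- `φ ∈ C_c^∞(U)`. -/
structure IsTest {F : Type*} [NormedAddCommGroup F] [NormedSpace ℝ F] (U : Set F)
    (φ : F → ℝ) : Prop where
  smooth : ContDiff ℝ ∞ φ
  compact_support : HasCompactSupport φ
  support_subset : tsupport φ ⊆ U

/-- `v ∈ H_0^1(Ω)` with weak gradient `G`: the pair `(v, G)` lies in the closure of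
`{(φ, ∇φ) : φ ∈ C_c^∞(Ω)}` in `L²(Ω) × L²(Ω; ℝ^N)`. -/
structure HasH10Gradient {N : ℕ} (Ω : Set (Space N)) (v : Space N → ℝ)
    (G : Space N → Space N) : Prop where
  memLp : MemLp v 2 (muSpace Ω)
  memLp_grad : MemLp G 2 (muSpace Ω)
  approx : ∃ φ : ℕ → Space N → ℝ, (∀ n, IsTest Ω (φ n)) ∧
    Tendsto (fun n => eLpNorm (fun x => φ n x - v x) 2 (muSpace Ω)) atTop (𝓝 0) ∧
    Tendsto (fun n => eLpNorm (fun x => gradient (φ n) x - G x) 2 (muSpace Ω)) atTop (𝓝 0)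

/-- The convex set `K_γ = {v ∈ H_0^1(Ω) : |∇v| ≤ γ a.e. in Ω}`. -/
def gradConvex {N : ℕ} (Ω : Set (Space N)) (γ : Space N → ℝ) : Set (Space N → ℝ) :=
  {v | ∃ G : Space N → Space N, HasH10Gradient Ω v G ∧ ∀ᵐ x ∂(muSpace Ω), ‖G x‖ ≤ γ x}

/-- `w' = ∂_t w` in the sense of distributions in `Q_T`. -/
def HasWeakTimeDeriv {N : ℕ} (Ω : Set (Space N)) (T : ℝ) (w w' : Space N × ℝ → ℝ) : Prop :=
  ∀ φ : Space N × ℝ → ℝ, IsTest (cyl Ω T) φ →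
    ∫ z, w z * deriv (fun t => φ (z.1, t)) z.2 ∂(muCyl Ω T) = -∫ z, w' z * φ z ∂(muCyl Ω T)

/-- `g ∈ W^{1,∞}(0, T; L^∞(Ω))` with `∂_t g = g'`, where `g` is the representative that is
continuous from `[0, T]` to `L^∞(Ω)`, so that `g(0)` has a meaning. -/
structure IsW1Inf {N : ℕ} (Ω : Set (Space N)) (T : ℝ) (g g' : Space N × ℝ → ℝ) : Prop where
  memLp : MemLp g ∞ (muCyl Ω T)
  memLp_deriv : MemLp g' ∞ (muCyl Ω T)
  weakDeriv : HasWeakTimeDeriv Ω T g g'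
  continuous_time : ∀ s ∈ Icc 0 T,
    Tendsto (fun t => eLpNorm (fun x => g (x, t) - g (x, s)) ∞ (muSpace Ω))
      (𝓝[Icc 0 T] s) (𝓝 0)

/-- `c - ½ ∇ · b ≥ l` in the sense of distributions in `Q_T`. -/
def WeaklyCoercive {N : ℕ} (Ω : Set (Space N)) (T l : ℝ) (b : Space N × ℝ → Space N)
    (c : Space N × ℝ → ℝ) : Prop :=
  ∀ φ : Space N × ℝ → ℝ, IsTest (cyl Ω T) φ → (∀ z, 0 ≤ φ z) →
    l * ∫ z, φ z ∂(muCyl Ω T) ≤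
      ∫ z, (c z * φ z + (1 / 2) * inner ℝ (b z) (gradient (fun y => φ (y, z.2)) z.1))
        ∂(muCyl Ω T)

/-- The data of the problem; `gt` is the time derivative of the threshold `g`. -/
structure Data (N : ℕ) where
  b : Space N × ℝ → Space N
  c : Space N × ℝ → ℝ
  f : Space N × ℝ → ℝ
  g : Space N × ℝ → ℝ
  gt : Space N × ℝ → ℝ
  u0 : Space N → ℝ

/-- The assumptions on the data, with lower bounds `l` and `m`. -/
structure Data.Admissible {N : ℕ} (d : Data N) (Ω : Set (Space N)) (T l m : ℝ) : Prop where
  b_memLp : MemLp d.b 2 (muCyl Ω T)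
  c_memLp : MemLp d.c 2 (muCyl Ω T)
  coercive : WeaklyCoercive Ω T l d.b d.c
  f_memLp : MemLp d.f 2 (muCyl Ω T)
  u0_mem : d.u0 ∈ gradConvex Ω (fun x => d.g (x, 0))
  g_W1Inf : IsW1Inf Ω T d.g d.gt
  g_lower : ∀ᵐ z ∂(muCyl Ω T), m ≤ d.g z

/-- The norms of `b`, `c`, `f` in `L²(Q_T)` and those of `g`, `∂_t g` in `L^∞(Q_T)` are at
most `M`. -/
structure Data.BoundedBy {N : ℕ} (d : Data N) (Ω : Set (Space N)) (T : ℝ) (M : ℝ≥0) :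
    Prop where
  b_le : eLpNorm d.b 2 (muCyl Ω T) ≤ M
  c_le : eLpNorm d.c 2 (muCyl Ω T) ≤ M
  f_le : eLpNorm d.f 2 (muCyl Ω T) ≤ M
  g_le : eLpNorm d.g ∞ (muCyl Ω T) ≤ M
  gt_le : eLpNorm d.gt ∞ (muCyl Ω T) ≤ M

/-- `u`, with spatial gradient `Du` and time derivative `ut`, solves the variational inequality
with data `d`, in the class `L^∞(0, T; W_0^{1,∞}(Ω)) ∩ C(closure of Q_T)`, `∂_t u ∈ L²(Q_T)`. -/
structure IsSolutionWith {N : ℕ} (Ω : Set (Space N)) (T : ℝ) (d : Data N)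
    (u : Space N × ℝ → ℝ) (Du : Space N × ℝ → Space N) (ut : Space N × ℝ → ℝ) : Prop where
  continuousOn : ContinuousOn u (closure Ω ×ˢ Icc 0 T)
  grad_memLp : MemLp Du ∞ (muCyl Ω T)
  grad : ∀ᵐ t ∂(muTime T), HasH10Gradient Ω (fun x => u (x, t)) (fun x => Du (x, t))
  deriv_memLp : MemLp ut 2 (muCyl Ω T)
  weakDeriv : HasWeakTimeDeriv Ω T u ut
  mem_convex : ∀ᵐ t ∂(muTime T), (fun x => u (x, t)) ∈ gradConvex Ω (fun x => d.g (x, t))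
  initial : ∀ᵐ x ∂(muSpace Ω), u (x, 0) = d.u0 x
  ineq : ∀ᵐ t ∂(muTime T), ∀ v ∈ gradConvex Ω (fun x => d.g (x, t)),
    ∫ x, d.f (x, t) * (v x - u (x, t)) ∂(muSpace Ω) ≤
      ∫ x, ut (x, t) * (v x - u (x, t)) ∂(muSpace Ω)
        + ∫ x, inner ℝ (d.b (x, t)) (Du (x, t)) * (v x - u (x, t)) ∂(muSpace Ω)
        + ∫ x, d.c (x, t) * u (x, t) * (v x - u (x, t)) ∂(muSpace Ω)

/-- `u` is a solution of the variational inequality with data `d`. -/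
def IsSolution {N : ℕ} (Ω : Set (Space N)) (T : ℝ) (d : Data N) (u : Space N × ℝ → ℝ) : Prop :=
  ∃ (Du : Space N × ℝ → Space N) (ut : Space N × ℝ → ℝ), IsSolutionWith Ω T d u Du ut

/-- The norm of `L^∞(0, T; L²(Ω))`. -/
def normLinfL2 {N : ℕ} (Ω : Set (Space N)) (T : ℝ) (w : Space N × ℝ → ℝ) : ℝ≥0∞ :=
  essSup (fun t => eLpNorm (fun x => w (x, t)) 2 (muSpace Ω)) (muTime T)

end GradVI

end

open GradVI

/-! Since `|∇uᵢ| ≤ gᵢ ≤ M`, integrating along a line bounds `uᵢ` and `∇uᵢ` uniformly. Put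
`β = ‖g₁ - g₂‖_∞` and `λ = m / (m + β)`: as `gᵢ ≥ m`, the functions `λ u₂(t)` and `λ u₁(t)` are
admissible test functions in the inequalities for `u₁` and `u₂`. Writing `rᵢ` for
`∂ₜuᵢ + bᵢ · ∇uᵢ + cᵢ uᵢ - fᵢ` and `w = u₁ - u₂`, adding the two inequalities gives
`∫ (r₁ - r₂) w ≤ -(β / m) (∫ r₁ u₁ + ∫ r₂ u₂)`. On the left `b₂, c₂, f₂` may be replaced by
`b₁, c₁, f₁` at the cost of their `L¹` distances. The distributional inequality for `(b₁, c₁)`,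
tested with smooth nonnegative approximations of `w²`, turns `∫ (b₁ · ∇w + c₁ w) w` into at least
`l ∫ w²`. Only `∫ ∂ₜw w`, half the derivative of `∫ w²`, remains, and Grönwall's inequality
concludes. -/

namespace GradVI

section Measures

variable {N : ℕ} {Ω : Set (Space N)}

theorem muCyl_eq_prod (Ω : Set (Space N)) (T : ℝ) :
    muCyl Ω T = (muSpace Ω).prod (muTime T) := by
  rw [muCyl, cyl, Measure.volume_eq_prod, ← Measure.prod_restrict]
  rfl

instance isFiniteMeasure_muTime (T : ℝ) : IsFiniteMeasure (muTime T) :=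
  ⟨by simp [muTime]⟩

theorem isFiniteMeasure_muSpace (hΩb : Bornology.IsBounded Ω) : IsFiniteMeasure (muSpace Ω) :=
  ⟨by simpa [muSpace] using hΩb.measure_lt_top⟩

instance sFinite_muSpace (Ω : Set (Space N)) : SFinite (muSpace Ω) := by
  unfold muSpace; infer_instance

instance isLocallyFiniteMeasure_muSpace (Ω : Set (Space N)) :
    IsLocallyFiniteMeasure (muSpace Ω) := by
  unfold muSpace; infer_instance

theorem isFiniteMeasure_muCyl (hΩb : Bornology.IsBounded Ω) (T : ℝ) :
    IsFiniteMeasure (muCyl Ω T) := by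
  have := isFiniteMeasure_muSpace hΩb
  rw [muCyl_eq_prod]
  infer_instance

end Measures

section Test

variable {F : Type*} [NormedAddCommGroup F] [NormedSpace ℝ F] {U : Set F} {φ ψ : F → ℝ}

theorem IsTest.sub (hφ : IsTest U φ) (hψ : IsTest U ψ) : IsTest U (fun x => φ x - ψ x) where
  smooth := hφ.smooth.sub hψ.smooth
  compact_support := hφ.compact_support.sub hψ.compact_support
  support_subset :=
    (tsupport_sub φ ψ).trans (union_subset hφ.support_subset hψ.support_subset)

theorem IsTest.const_mul (r : ℝ) (hφ : IsTest U φ) : IsTest U (fun x => r * φ x) where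
  smooth := contDiff_const.mul hφ.smooth
  compact_support := hφ.compact_support.mul_left
  support_subset := (tsupport_mul_subset_right (f := fun _ => r)).trans hφ.support_subset

theorem IsTest.comp {η : ℝ → ℝ} (hη : ContDiff ℝ ∞ η) (h0 : η 0 = 0) (hφ : IsTest U φ) :
    IsTest U (fun x => η (φ x)) where
  smooth := hη.comp hφ.smooth
  compact_support := hφ.compact_support.comp_left h0
  support_subset := (tsupport_comp_subset h0 φ).trans hφ.support_subset

theorem IsTest.eq_zero (hφ : IsTest U φ) {x : F} (hx : x ∉ U) : φ x = 0 :=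
  image_eq_zero_of_notMem_tsupport fun h => hx (hφ.support_subset h)

theorem IsTest.differentiable (hφ : IsTest U φ) : Differentiable ℝ φ :=
  hφ.smooth.differentiable (by simp)

theorem IsTest.continuous_fderiv (hφ : IsTest U φ) : Continuous (fderiv ℝ φ) :=
  hφ.smooth.continuous_fderiv (by simp)

end Test

section Gradient

variable {F : Type*} [NormedAddCommGroup F] [InnerProductSpace ℝ F] [CompleteSpace F]
  {U : Set F} {φ ψ : F → ℝ}

theorem norm_gradient (φ : F → ℝ) (x : F) : ‖gradient φ x‖ = ‖fderiv ℝ φ x‖ := by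
  simp [gradient]

theorem IsTest.hasGradientAt (hφ : IsTest U φ) (x : F) : HasGradientAt φ (gradient φ x) x :=
  (hφ.differentiable x).hasGradientAt

theorem IsTest.continuous_gradient (hφ : IsTest U φ) : Continuous (gradient φ) :=
  (LinearIsometryEquiv.continuous _).comp hφ.continuous_fderiv

theorem IsTest.hasCompactSupport_gradient (hφ : IsTest U φ) : HasCompactSupport (gradient φ) :=
  (hφ.compact_support.fderiv (𝕜 := ℝ)).comp_left
    (g := fun L => (InnerProductSpace.toDual ℝ F).symm L) (map_zero _)

theorem IsTest.gradient_eq_zero (hφ : IsTest U φ) {x : F} (hx : x ∉ U) : gradient φ x = 0 := by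
  have : fderiv ℝ φ x = 0 := by
    by_contra h
    exact hx (hφ.support_subset (support_fderiv_subset ℝ h))
  simp [gradient, this]

theorem IsTest.gradient_sub (hφ : IsTest U φ) (hψ : IsTest U ψ) (x : F) :
    gradient (fun x => φ x - ψ x) x = gradient φ x - gradient ψ x := by
  refine HasGradientAt.gradient ?_
  rw [hasGradientAt_iff_hasFDerivAt, map_sub]
  exact (hφ.hasGradientAt x).hasFDerivAt.sub (hψ.hasGradientAt x).hasFDerivAt

theorem IsTest.gradient_comp {η : ℝ → ℝ} (hη : Differentiable ℝ η) (hφ : IsTest U φ) (x : F) :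
    gradient (fun x => η (φ x)) x = deriv η (φ x) • gradient φ x := by
  refine HasGradientAt.gradient ?_
  rw [hasGradientAt_iff_hasFDerivAt, map_smul]
  exact (hη (φ x)).hasDerivAt.comp_hasFDerivAt x (hφ.hasGradientAt x).hasFDerivAt

theorem IsTest.gradient_const_mul (r : ℝ) (hφ : IsTest U φ) (x : F) :
    gradient (fun x => r * φ x) x = r • gradient φ x := by
  simpa using hφ.gradient_comp (η := fun s => r * s) (by fun_prop) x

end Gradient

section L2

variable {α E : Type*} [MeasurableSpace α] {μ : Measure α} [NormedAddCommGroup E]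
  [InnerProductSpace ℝ E]

theorem integrable_inner_of_memLp {G H : α → E} (hG : MemLp G 2 μ) (hH : MemLp H 2 μ) :
    Integrable (fun x => inner ℝ (G x) (H x)) μ :=
  memLp_one_iff_integrable.1 (hG.of_bilin (fun a b => inner ℝ a b) 1 hH (hG.1.inner hH.1)
    (Eventually.of_forall fun x => by
      simpa using nnnorm_inner_le_nnnorm (𝕜 := ℝ) (G x) (H x)))

theorem eLpNorm_inner_le {G H : α → E} (hG : AEStronglyMeasurable G μ)
    (hH : AEStronglyMeasurable H μ) :
    eLpNorm (fun x => inner ℝ (G x) (H x)) 1 μ ≤ eLpNorm G 2 μ * eLpNorm H 2 μ := by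
  simpa only [ENNReal.coe_one, one_mul] using
    eLpNorm_le_eLpNorm_mul_eLpNorm_of_nnnorm (p := 2) (q := 2) (r := 1) hG hH
      (fun a b => inner ℝ a b) 1
      (Eventually.of_forall fun x => by
        simpa using nnnorm_inner_le_nnnorm (𝕜 := ℝ) (G x) (H x))

theorem tendsto_integral_inner_of_tendsto_eLpNorm {F : ℕ → α → E} {G H : α → E}
    (hF : ∀ n, MemLp (F n) 2 μ) (hG : MemLp G 2 μ) (hH : MemLp H 2 μ)
    (h : Tendsto (fun n => eLpNorm (fun x => F n x - G x) 2 μ) atTop (𝓝 0)) :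
    Tendsto (fun n => ∫ x, inner ℝ (F n x) (H x) ∂μ) atTop (𝓝 (∫ x, inner ℝ (G x) (H x) ∂μ)) := by
  have bound (n) : eLpNorm ((fun x => inner ℝ (F n x) (H x)) - fun x => inner ℝ (G x) (H x)) 1 μ
      ≤ eLpNorm (fun x => F n x - G x) 2 μ * eLpNorm H 2 μ := by
    have := eLpNorm_inner_le ((hF n).1.sub hG.1) hH.1
    simp only [Pi.sub_apply, inner_sub_left] at this
    exact this
  have bound_tendsto := ENNReal.Tendsto.mul_const h (Or.inr hH.2.ne)
  rw [zero_mul] at bound_tendsto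
  exact tendsto_integral_of_L1' _ (integrable_inner_of_memLp hG hH).1
    (Eventually.of_forall fun n => integrable_inner_of_memLp (hF n) hH)
    (tendsto_of_tendsto_of_tendsto_of_le_of_le tendsto_const_nhds bound_tendsto
      (fun _ => zero_le) bound)

theorem tendsto_eLpNorm_sub_sub {E : Type*} [NormedAddCommGroup E] {p : ℝ≥0∞} (hp : 1 ≤ p)
    {F₁ F₂ : ℕ → α → E} {G₁ G₂ : α → E}
    (hF₁ : ∀ n, MemLp (F₁ n) p μ) (hF₂ : ∀ n, MemLp (F₂ n) p μ)
    (hG₁ : MemLp G₁ p μ) (hG₂ : MemLp G₂ p μ)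
    (h₁ : Tendsto (fun n => eLpNorm (fun x => F₁ n x - G₁ x) p μ) atTop (𝓝 0))
    (h₂ : Tendsto (fun n => eLpNorm (fun x => F₂ n x - G₂ x) p μ) atTop (𝓝 0)) :
    Tendsto (fun n => eLpNorm (fun x => F₁ n x - F₂ n x - (G₁ x - G₂ x)) p μ) atTop (𝓝 0) := by
  refine tendsto_of_tendsto_of_tendsto_of_le_of_le tendsto_const_nhds
    (add_zero (0 : ℝ≥0∞) ▸ h₁.add h₂) (fun _ => zero_le) fun n => ?_
  simp only [sub_sub_sub_comm _ _ (G₁ _)]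
  exact eLpNorm_sub_le ((hF₁ n).sub hG₁).1 ((hF₂ n).sub hG₂).1 hp

theorem tendsto_eLpNorm_const_smul_sub {E : Type*} [NormedAddCommGroup E] [NormedSpace ℝ E]
    {p : ℝ≥0∞} {F : ℕ → α → E} {G : α → E} (r : ℝ)
    (h : Tendsto (fun n => eLpNorm (fun x => F n x - G x) p μ) atTop (𝓝 0)) :
    Tendsto (fun n => eLpNorm (fun x => r • F n x - r • G x) p μ) atTop (𝓝 0) := by
  have := ENNReal.Tendsto.const_mul (a := ‖r‖ₑ) h (Or.inr (by simp))
  simp only [mul_zero, ← eLpNorm_const_smul] at this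
  simp only [← smul_sub]
  exact this

end L2

section H10

variable {N : ℕ} {Ω : Set (Space N)} {φ ψ v v₁ v₂ : Space N → ℝ} {G G₁ G₂ : Space N → Space N}

theorem IsTest.memLp (hφ : IsTest Ω φ) (p : ℝ≥0∞) : MemLp φ p (muSpace Ω) :=
  (hφ.smooth.continuous.memLp_of_hasCompactSupport hφ.compact_support).restrict _

theorem IsTest.memLp_gradient (hφ : IsTest Ω φ) (p : ℝ≥0∞) :
    MemLp (gradient φ) p (muSpace Ω) :=
  (hφ.continuous_gradient.memLp_of_hasCompactSupport hφ.hasCompactSupport_gradient).restrict _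

theorem HasH10Gradient.sub (h₁ : HasH10Gradient Ω v₁ G₁) (h₂ : HasH10Gradient Ω v₂ G₂) :
    HasH10Gradient Ω (fun x => v₁ x - v₂ x) (fun x => G₁ x - G₂ x) := by
  obtain ⟨φ, hφ, hφv, hφG⟩ := h₁.approx
  obtain ⟨ψ, hψ, hψv, hψG⟩ := h₂.approx
  refine ⟨h₁.memLp.sub h₂.memLp, h₁.memLp_grad.sub h₂.memLp_grad, fun n x => φ n x - ψ n x,
    fun n => (hφ n).sub (hψ n), ?_, ?_⟩
  · exact tendsto_eLpNorm_sub_sub one_le_two (fun n => (hφ n).memLp 2) (fun n => (hψ n).memLp 2)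
      h₁.memLp h₂.memLp hφv hψv
  · simp only [(hφ _).gradient_sub (hψ _)]
    exact tendsto_eLpNorm_sub_sub one_le_two (fun n => (hφ n).memLp_gradient 2)
      (fun n => (hψ n).memLp_gradient 2) h₁.memLp_grad h₂.memLp_grad hφG hψG

theorem HasH10Gradient.const_mul (r : ℝ) (h : HasH10Gradient Ω v G) :
    HasH10Gradient Ω (fun x => r * v x) (fun x => r • G x) := by
  obtain ⟨φ, hφ, hφv, hφG⟩ := h.approx
  refine ⟨h.memLp.const_mul r, h.memLp_grad.const_smul r, fun n x => r * φ n x,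
    fun n => (hφ n).const_mul r, tendsto_eLpNorm_const_smul_sub r hφv, ?_⟩
  simp only [(hφ _).gradient_const_mul r]
  exact tendsto_eLpNorm_const_smul_sub r hφG

theorem IsTest.integral_inner_gradient_smul (hφ : IsTest Ω φ) (hψ : IsTest Ω ψ) (e : Space N) :
    ∫ x, inner ℝ (gradient φ x) (ψ x • e) ∂(muSpace Ω) =
      -∫ x, inner ℝ (φ x) (inner ℝ (gradient ψ x) e) ∂(muSpace Ω) := by
  have hφ' : Continuous fun x => fderiv ℝ φ x e := hφ.continuous_fderiv.clm_apply continuous_const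
  have hψ' : Continuous fun x => fderiv ℝ ψ x e := hψ.continuous_fderiv.clm_apply continuous_const
  have parts := integral_mul_fderiv_eq_neg_fderiv_mul_of_integrable (μ := volume) (v := e)
    ((hφ'.mul hψ.smooth.continuous).integrable_of_hasCompactSupport hψ.compact_support.mul_left)
    ((hφ.smooth.continuous.mul hψ').integrable_of_hasCompactSupport hφ.compact_support.mul_right)
    ((hφ.smooth.continuous.mul hψ.smooth.continuous).integrable_of_hasCompactSupport
      hψ.compact_support.mul_left)
    (fun x _ => hφ.differentiable x) (fun x _ => hψ.differentiable x)
  rw [muSpace, setIntegral_eq_integral_of_forall_compl_eq_zero fun x hx => by simp [hψ.eq_zero hx],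
    setIntegral_eq_integral_of_forall_compl_eq_zero fun x hx => by simp [hφ.eq_zero hx]]
  simpa [inner_smul_right, inner_gradient_left, mul_comm] using (neg_eq_iff_eq_neg.2 parts).symm

theorem HasH10Gradient.integral_inner_smul (h : HasH10Gradient Ω v G) (hψ : IsTest Ω ψ)
    (e : Space N) :
    ∫ x, inner ℝ (G x) (ψ x • e) ∂(muSpace Ω) =
      -∫ x, inner ℝ (v x) (inner ℝ (gradient ψ x) e) ∂(muSpace Ω) := by
  obtain ⟨φ, hφ, hφv, hφG⟩ := h.approx
  have hψe : MemLp (fun x => ψ x • e) 2 (muSpace Ω) :=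
    ((hψ.smooth.continuous.smul continuous_const).memLp_of_hasCompactSupport
      hψ.compact_support.smul_right).restrict _
  have hψ'e : MemLp (fun x => inner ℝ (gradient ψ x) e) 2 (muSpace Ω) :=
    (hψ.memLp_gradient 2).inner_const e
  refine tendsto_nhds_unique (tendsto_integral_inner_of_tendsto_eLpNorm
    (fun n => (hφ n).memLp_gradient 2) h.memLp_grad hψe hφG) ?_
  simp only [(hφ _).integral_inner_gradient_smul hψ]
  exact (tendsto_integral_inner_of_tendsto_eLpNorm (fun n => (hφ n).memLp 2) h.memLp hψ'e hφv).neg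

theorem HasH10Gradient.ae_eq_zero (hΩ : IsOpen Ω) (h : HasH10Gradient Ω (fun _ => 0) G) :
    ∀ᵐ x ∂(muSpace Ω), G x = 0 := by
  rw [muSpace, ae_restrict_iff' hΩ.measurableSet]
  refine hΩ.ae_eq_zero_of_integral_contDiff_smul_eq_zero
    (locallyIntegrableOn_of_locallyIntegrable_restrict
      (h.memLp_grad.locallyIntegrable one_le_two)) fun ψ hψs hψc hψΩ => ?_
  have hψ : IsTest Ω ψ := ⟨hψs, hψc, hψΩ⟩
  have hGψ : Integrable (fun x => ψ x • G x) (muSpace Ω) :=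
    memLp_one_iff_integrable.1 (h.memLp_grad.smul (r := 1) (hψ.memLp 2))
  rw [← setIntegral_eq_integral_of_forall_compl_eq_zero
    fun x hx => by rw [hψ.eq_zero hx, zero_smul]]
  refine ext_inner_left ℝ fun e => ?_
  rw [inner_zero_right, ← muSpace, ← integral_inner hGψ]
  have := h.integral_inner_smul hψ e
  simpa only [inner_smul_right, real_inner_comm e, inner_zero_left, integral_zero, neg_zero]
    using this

theorem HasH10Gradient.ae_eq (hΩ : IsOpen Ω) (h₁ : HasH10Gradient Ω v G₁)
    (h₂ : HasH10Gradient Ω v G₂) : ∀ᵐ x ∂(muSpace Ω), G₁ x = G₂ x := by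
  have h := h₁.sub h₂
  simp only [sub_self] at h
  filter_upwards [h.ae_eq_zero hΩ] with x hx using sub_eq_zero.1 hx

end H10

section SupBound

variable {N : ℕ} {Ω : Set (Space N)} {φ v : Space N → ℝ} {G : Space N → Space N} {R L : ℝ}

theorem IsTest.abs_le_integral_norm_gradient (hφ : IsTest Ω φ) (hR : 0 ≤ R)
    (hΩR : Ω ⊆ Metric.ball 0 R) {e : Space N} (he : ‖e‖ = 1) {x : Space N} (hx : x ∈ Ω) :
    |φ x| ≤ ∫ s in (0 : ℝ)..2 * R, ‖gradient φ (x - s • e)‖ := by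
  have hline : Continuous fun s : ℝ => x - s • e := by fun_prop
  have hderiv (s : ℝ) : HasDerivAt (fun s : ℝ => φ (x - s • e)) (fderiv ℝ φ (x - s • e) (-e)) s :=
    (hφ.differentiable _).hasFDerivAt.comp_hasDerivAt s
      (by simpa using ((hasDerivAt_id s).smul_const e).const_sub x)
  have hcont : Continuous fun s : ℝ => fderiv ℝ φ (x - s • e) (-e) :=
    (hφ.continuous_fderiv.comp hline).clm_apply continuous_const
  have hend : x - (2 * R) • e ∉ Ω := by
    intro h
    have h1 := mem_ball_zero_iff.1 (hΩR h)
    have h2 := mem_ball_zero_iff.1 (hΩR hx)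
    have h3 : ‖(2 * R) • e‖ ≤ ‖x‖ + ‖x - (2 * R) • e‖ := by
      simpa using norm_sub_le x (x - (2 * R) • e)
    rw [norm_smul, he, Real.norm_of_nonneg (by positivity)] at h3
    linarith
  have hftc := intervalIntegral.integral_eq_sub_of_hasDerivAt (a := 0) (b := 2 * R)
    (fun s _ => hderiv s) (hcont.intervalIntegrable _ _)
  simp only [hφ.eq_zero hend, zero_smul, sub_zero, zero_sub] at hftc
  rw [← abs_neg, ← hftc, ← Real.norm_eq_abs]
  refine intervalIntegral.norm_integral_le_of_norm_le (by positivity)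
    (Eventually.of_forall fun s _ => ?_)
    ((hφ.continuous_gradient.comp hline).norm.intervalIntegrable _ _)
  rw [norm_gradient]
  simpa [he] using (fderiv ℝ φ (x - s • e)).le_opNorm (-e)

/- Bounding the excess over `L`, rather than the supremum, gives an estimate that passes to `L²`
limits of test functions. -/
theorem IsTest.ofReal_abs_sub_le (hφ : IsTest Ω φ) (hR : 0 ≤ R) (hΩR : Ω ⊆ Metric.ball 0 R)
    {e : Space N} (he : ‖e‖ = 1) (hL : 0 ≤ L) {x : Space N} (hx : x ∈ Ω) :
    ENNReal.ofReal (|φ x| - 2 * R * L) ≤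
      ∫⁻ s in Ioc 0 (2 * R), ENNReal.ofReal (‖gradient φ (x - s • e)‖ - L) := by
  have hcont : Continuous fun s : ℝ => ‖gradient φ (x - s • e)‖ :=
    (hφ.continuous_gradient.comp (by fun_prop)).norm
  calc ENNReal.ofReal (|φ x| - 2 * R * L)
      ≤ ENNReal.ofReal (∫ s in Ioc 0 (2 * R), ‖gradient φ (x - s • e)‖) -
          ENNReal.ofReal (2 * R * L) := by
        rw [ENNReal.ofReal_sub _ (by positivity),
          ← intervalIntegral.integral_of_le (by positivity : (0 : ℝ) ≤ 2 * R)]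
        gcongr
        exact hφ.abs_le_integral_norm_gradient hR hΩR he hx
    _ = (∫⁻ s in Ioc 0 (2 * R), ENNReal.ofReal ‖gradient φ (x - s • e)‖) -
          ∫⁻ _ in Ioc 0 (2 * R), ENNReal.ofReal L := by
        rw [ofReal_integral_eq_lintegral_ofReal
          (hcont.integrableOn_Icc.mono_set Ioc_subset_Icc_self)
          (Eventually.of_forall fun s => norm_nonneg _), setLIntegral_const, Real.volume_Ioc,
          sub_zero, mul_comm (2 * R), ENNReal.ofReal_mul hL]
    _ ≤ ∫⁻ s in Ioc 0 (2 * R), ENNReal.ofReal (‖gradient φ (x - s • e)‖ - L) := by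
        simp only [ENNReal.ofReal_sub _ hL]
        exact lintegral_sub_le _ _ measurable_const

theorem IsTest.lintegral_ofReal_abs_sub_le (hφ : IsTest Ω φ) (hR : 0 ≤ R) (hΩ : MeasurableSet Ω)
    (hΩR : Ω ⊆ Metric.ball 0 R) {e : Space N} (he : ‖e‖ = 1) (hL : 0 ≤ L) :
    ∫⁻ x, ENNReal.ofReal (|φ x| - 2 * R * L) ∂(muSpace Ω) ≤
      ENNReal.ofReal (2 * R) * ∫⁻ x, ENNReal.ofReal (‖gradient φ x‖ - L) ∂(muSpace Ω) := by
  set h : Space N → ℝ≥0∞ := fun x => ENNReal.ofReal (‖gradient φ x‖ - L)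
  have hh : Measurable h := (hφ.continuous_gradient.norm.measurable.sub_const L).ennreal_ofReal
  have hsupp : Function.support h ⊆ Ω := fun x hx => by
    by_contra hxΩ
    exact hx (by simp [h, hφ.gradient_eq_zero hxΩ, hL])
  calc ∫⁻ x, ENNReal.ofReal (|φ x| - 2 * R * L) ∂(muSpace Ω)
      ≤ ∫⁻ x, (∫⁻ s in Ioc 0 (2 * R), h (x - s • e)) ∂(muSpace Ω) :=
        setLIntegral_mono' hΩ fun x hx => hφ.ofReal_abs_sub_le hR hΩR he hL hx
    _ ≤ ∫⁻ x, ∫⁻ s in Ioc 0 (2 * R), h (x - s • e) :=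
        lintegral_mono' Measure.restrict_le_self le_rfl
    _ = ∫⁻ s in Ioc 0 (2 * R), ∫⁻ x, h (x - s • e) :=
        lintegral_lintegral_swap (hh.comp (by fun_prop)).aemeasurable
    _ = ENNReal.ofReal (2 * R) * ∫⁻ x, h x ∂(muSpace Ω) := by
        simp_rw [lintegral_sub_right_eq_self h]
        rw [setLIntegral_const, Real.volume_Ioc, sub_zero, mul_comm, muSpace,
          setLIntegral_eq_of_support_subset hsupp]

theorem tendsto_eLpNorm_zero_of_exponent_le {α E : Type*} [MeasurableSpace α] {μ : Measure α}
    [IsFiniteMeasure μ] [NormedAddCommGroup E] {p q : ℝ≥0∞} (hpq : p ≤ q) {F : ℕ → α → E}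
    (hF : ∀ n, AEStronglyMeasurable (F n) μ)
    (h : Tendsto (fun n => eLpNorm (F n) q μ) atTop (𝓝 0)) :
    Tendsto (fun n => eLpNorm (F n) p μ) atTop (𝓝 0) := by
  rcases eq_or_ne p 0 with rfl | hp
  · simp
  have hc : μ univ ^ (1 / p.toReal - 1 / q.toReal) ≠ ⊤ := by
    refine ENNReal.rpow_ne_top_of_nonneg (sub_nonneg.2 ?_) (measure_ne_top _ _)
    rcases eq_or_ne q ⊤ with rfl | hq
    · simp
    · exact one_div_le_one_div_of_le (ENNReal.toReal_pos hp (ne_top_of_le_ne_top hq hpq))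
        (ENNReal.toReal_mono hq hpq)
  have hlim := ENNReal.Tendsto.mul_const h (Or.inr hc)
  rw [zero_mul] at hlim
  exact tendsto_of_tendsto_of_tendsto_of_le_of_le tendsto_const_nhds hlim (fun _ => zero_le)
    fun n => eLpNorm_le_eLpNorm_mul_rpow_measure_univ hpq (hF n)

theorem lintegral_ofReal_norm_sub_le {α E : Type*} [MeasurableSpace α] {μ : Measure α}
    [NormedAddCommGroup E] {F G : α → E} (hF : AEStronglyMeasurable F μ) (a : ℝ) :
    ∫⁻ x, ENNReal.ofReal (‖G x‖ - a) ∂μ ≤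
      ∫⁻ x, ENNReal.ofReal (‖F x‖ - a) ∂μ + eLpNorm (fun x => F x - G x) 1 μ := by
  rw [eLpNorm_one_eq_lintegral_enorm,
    ← lintegral_add_left' (hF.norm.aemeasurable.sub_const a).ennreal_ofReal]
  refine lintegral_mono fun x => ?_
  rw [← ofReal_norm]
  refine (ENNReal.ofReal_le_ofReal ?_).trans ENNReal.ofReal_add_le
  have := norm_sub_norm_le (G x) (F x)
  rw [norm_sub_rev] at this
  linarith

theorem HasH10Gradient.ae_abs_le (hN : 1 ≤ N) (hv : HasH10Gradient Ω v G) (hR : 0 ≤ R)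
    (hΩ : MeasurableSet Ω) (hΩR : Ω ⊆ Metric.ball 0 R) (hL : 0 ≤ L)
    (hG : ∀ᵐ x ∂(muSpace Ω), ‖G x‖ ≤ L) :
    ∀ᵐ x ∂(muSpace Ω), |v x| ≤ 2 * R * L := by
  have := isFiniteMeasure_muSpace (Metric.isBounded_ball.subset hΩR)
  obtain ⟨φ, hφ, hφv, hφG⟩ := hv.approx
  have he : ‖(EuclideanSpace.single ⟨0, hN⟩ 1 : Space N)‖ = 1 := by simp
  have gradient_excess (n) : ∫⁻ x, ENNReal.ofReal (‖gradient (φ n) x‖ - L) ∂(muSpace Ω) ≤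
      eLpNorm (fun x => gradient (φ n) x - G x) 1 (muSpace Ω) := by
    rw [eLpNorm_one_eq_lintegral_enorm]
    refine lintegral_mono_ae ?_
    filter_upwards [hG] with x hx
    rw [← ofReal_norm]
    exact ENNReal.ofReal_le_ofReal ((sub_le_sub_left hx _).trans (norm_sub_norm_le _ _))
  have lim := (ENNReal.Tendsto.const_mul (a := ENNReal.ofReal (2 * R))
    (tendsto_eLpNorm_zero_of_exponent_le one_le_two
      (fun n => (((hφ n).memLp_gradient 2).sub hv.memLp_grad).1) hφG)
    (Or.inr ENNReal.ofReal_ne_top)).add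
    (tendsto_eLpNorm_zero_of_exponent_le one_le_two
      (fun n => (((hφ n).memLp 2).sub hv.memLp).1) hφv)
  rw [mul_zero, add_zero] at lim
  have hzero : ∫⁻ x, ENNReal.ofReal (‖v x‖ - 2 * R * L) ∂(muSpace Ω) = 0 := by
    refine le_antisymm (ge_of_tendsto' lim fun n => ?_) zero_le
    refine (lintegral_ofReal_norm_sub_le ((hφ n).memLp 2).1 _).trans (add_le_add ?_ le_rfl)
    refine ((hφ n).lintegral_ofReal_abs_sub_le hR hΩ hΩR he hL).trans ?_
    gcongr
    exact gradient_excess n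
  rw [lintegral_eq_zero_iff' ((hv.memLp.1.norm.aemeasurable).sub_const _).ennreal_ofReal] at hzero
  filter_upwards [hzero] with x hx
  exact sub_nonpos.1 (ENNReal.ofReal_eq_zero.1 hx)

end SupBound

section Square

theorem exists_smooth_truncated_sq (K : ℝ) :
    ∃ (η : ℝ → ℝ) (A : ℝ≥0), ContDiff ℝ ∞ η ∧ η 0 = 0 ∧ (∀ s, 0 ≤ η s) ∧
      (∀ s, |s| ≤ K → η s = s ^ 2 ∧ deriv η s = 2 * s) ∧
      LipschitzWith A η ∧ LipschitzWith A (deriv η) := by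
  let χ : ContDiffBump (0 : ℝ) := ⟨|K| + 1, |K| + 2, by positivity, by linarith⟩
  have hη : ContDiff ℝ ∞ fun s => s ^ 2 * χ s := (contDiff_id.pow 2).mul χ.contDiff
  have hηc : HasCompactSupport fun s => s ^ 2 * χ s := χ.hasCompactSupport.mul_left
  obtain ⟨A, hA⟩ := hη.lipschitzWith_of_hasCompactSupport hηc (by simp)
  obtain ⟨B, hB⟩ := (contDiff_infty_iff_deriv.1 hη).2.lipschitzWith_of_hasCompactSupport
    hηc.deriv (by simp)
  refine ⟨_, max A B, hη, by simp, fun s => mul_nonneg (sq_nonneg s) χ.nonneg, fun s hs => ?_,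
    hA.weaken (le_max_left _ _), hB.weaken (le_max_right _ _)⟩
  have heq : (fun s => s ^ 2 * χ s) =ᶠ[𝓝 s] fun s => s ^ 2 := by
    filter_upwards [χ.eventuallyEq_one_of_mem_ball (x := s)
      (by simpa [χ] using hs.trans_lt ((le_abs_self K).trans_lt (lt_add_one _)))] with r hr
    simp [hr]
  exact ⟨heq.eq_of_nhds, by simp [heq.deriv_eq]⟩

variable {N : ℕ} {Ω : Set (Space N)} {v : Space N → ℝ} {G : Space N → Space N}

theorem eLpNorm_comp_sub_comp_le {α E F : Type*} [MeasurableSpace α] {μ : Measure α}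
    [NormedAddCommGroup E] [NormedAddCommGroup F] {η : E → F} {A : ℝ≥0} (hη : LipschitzWith A η)
    (p : ℝ≥0∞) (v w : α → E) :
    eLpNorm (fun x => η (v x) - η (w x)) p μ ≤ A * eLpNorm (fun x => v x - w x) p μ := by
  rw [← ENNReal.ofReal_coe_nnreal]
  exact eLpNorm_le_mul_eLpNorm_of_ae_le_mul
    (Eventually.of_forall fun x => by simpa [dist_eq_norm] using hη.dist_le_mul (v x) (w x)) p

theorem IsTest.eLpNorm_gradient_comp_sub_le {φ : Space N → ℝ} (hφ : IsTest Ω φ) {η : ℝ → ℝ}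
    {A B : ℝ≥0} (hη : ContDiff ℝ ∞ η) (hA : LipschitzWith A η) (hB : LipschitzWith B (deriv η))
    {L : ℝ≥0} (hv : AEStronglyMeasurable v (muSpace Ω)) (hG : AEStronglyMeasurable G (muSpace Ω))
    (hGL : ∀ᵐ x ∂(muSpace Ω), ‖G x‖ ≤ L) {p : ℝ≥0∞} (hp : 1 ≤ p) :
    eLpNorm (fun x => gradient (fun x => η (φ x)) x - deriv η (v x) • G x) p (muSpace Ω) ≤
      A * eLpNorm (fun x => gradient φ x - G x) p (muSpace Ω) +
        L * (B * eLpNorm (fun x => φ x - v x) p (muSpace Ω)) := by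
  have hφ' := hφ.smooth.continuous.aestronglyMeasurable (μ := muSpace Ω)
  have split : (fun x => gradient (fun x => η (φ x)) x - deriv η (v x) • G x) =
      (fun x => deriv η (φ x) • (gradient φ x - G x)) +
        fun x => (deriv η (φ x) - deriv η (v x)) • G x := by
    funext x
    rw [hφ.gradient_comp (hη.differentiable (by simp)), Pi.add_apply, smul_sub, sub_smul]
    abel
  rw [split]
  refine (eLpNorm_add_le ?_ ?_ hp).trans (add_le_add ?_ ?_)
  · exact (hB.continuous.comp_aestronglyMeasurable hφ').smul
      (hφ.continuous_gradient.aestronglyMeasurable.sub hG)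
  · exact ((hB.continuous.comp_aestronglyMeasurable hφ').sub
      (hB.continuous.comp_aestronglyMeasurable hv)).smul hG
  · rw [← ENNReal.ofReal_coe_nnreal]
    refine eLpNorm_le_mul_eLpNorm_of_ae_le_mul (Eventually.of_forall fun x => ?_) p
    rw [norm_smul]
    gcongr
    exact norm_deriv_le_of_lipschitz hA
  · refine le_trans ?_ (mul_le_mul_right (eLpNorm_comp_sub_comp_le hB p φ v) _)
    rw [← ENNReal.ofReal_coe_nnreal]
    refine eLpNorm_le_mul_eLpNorm_of_ae_le_mul ?_ p
    filter_upwards [hGL] with x hx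
    rw [norm_smul, mul_comm]
    gcongr

/-- `v` is a nonnegative element of `H_0^1(Ω)` with weak gradient `G`, in the sense that `(v, G)`
is a limit in `L²` of pairs `(φ, ∇φ)` with nonnegative test functions `φ`. Weak coercivity extends
to such pairs. -/
structure HasNonnegH10Gradient {N : ℕ} (Ω : Set (Space N)) (v : Space N → ℝ)
    (G : Space N → Space N) : Prop where
  memLp : MemLp v 2 (muSpace Ω)
  memLp_grad : MemLp G 2 (muSpace Ω)
  approx : ∃ φ : ℕ → Space N → ℝ, (∀ n, IsTest Ω (φ n) ∧ ∀ x, 0 ≤ φ n x) ∧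
    Tendsto (fun n => eLpNorm (fun x => φ n x - v x) 2 (muSpace Ω)) atTop (𝓝 0) ∧
    Tendsto (fun n => eLpNorm (fun x => gradient (φ n) x - G x) 2 (muSpace Ω)) atTop (𝓝 0)

theorem HasH10Gradient.sq (hv : HasH10Gradient Ω v G) {K : ℝ} {L : ℝ≥0}
    (hvK : ∀ᵐ x ∂(muSpace Ω), |v x| ≤ K) (hGL : ∀ᵐ x ∂(muSpace Ω), ‖G x‖ ≤ L) :
    HasNonnegH10Gradient Ω (fun x => v x ^ 2) (fun x => (2 * v x) • G x) := by
  obtain ⟨η, A, hη, hη0, hηn, hηK, hA, hA'⟩ := exists_smooth_truncated_sq K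
  obtain ⟨φ, hφ, hφv, hφG⟩ := hv.approx
  have limv := ENNReal.Tendsto.const_mul (a := A) hφv (Or.inr ENNReal.coe_ne_top)
  have limG := (ENNReal.Tendsto.const_mul (a := A) hφG (Or.inr ENNReal.coe_ne_top)).add
    (ENNReal.Tendsto.const_mul (a := L) limv (Or.inr ENNReal.coe_ne_top))
  simp only [mul_zero, add_zero] at limv limG
  refine ⟨hv.memLp.of_le_mul (c := K) (hv.memLp.1.pow 2) ?_,
    hv.memLp_grad.of_le_mul (c := 2 * K) ((hv.memLp.1.const_mul 2).smul hv.memLp_grad.1) ?_,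
    fun n x => η (φ n x), fun n => ⟨(hφ n).comp hη hη0, fun x => hηn _⟩, ?_, ?_⟩
  · filter_upwards [hvK] with x hx
    rw [norm_pow, pow_two]
    gcongr
    exact hx
  · filter_upwards [hvK] with x hx
    rw [norm_smul, norm_mul, Real.norm_two]
    gcongr
    exact hx
  · refine tendsto_of_tendsto_of_tendsto_of_le_of_le tendsto_const_nhds limv
      (fun _ => zero_le) fun n => ?_
    refine le_of_eq_of_le (eLpNorm_congr_ae ?_) (eLpNorm_comp_sub_comp_le hA 2 (φ n) v)
    filter_upwards [hvK] with x hx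
    rw [(hηK _ hx).1]
  · refine tendsto_of_tendsto_of_tendsto_of_le_of_le tendsto_const_nhds limG
      (fun _ => zero_le) fun n => ?_
    refine le_of_eq_of_le (eLpNorm_congr_ae ?_) ((hφ n).eLpNorm_gradient_comp_sub_le hη hA hA'
      hv.memLp.1 hv.memLp_grad.1 hGL one_le_two)
    filter_upwards [hvK] with x hx
    rw [(hηK _ hx).2]

end Square

section Nonneg

variable {F : Type*} [NormedAddCommGroup F] [NormedSpace ℝ F] [FiniteDimensional ℝ F]
  [MeasurableSpace F] [BorelSpace F] {μ : Measure F} [μ.IsAddHaarMeasure]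

theorem isTest_normed_contDiffBump_const_sub (ρ : ContDiffBump (0 : F)) {x : F} {U : Set F}
    (hU : Metric.closedBall x ρ.rOut ⊆ U) : IsTest U (fun t => ρ.normed μ (x - t)) := by
  have hsub : Function.support (fun t => ρ.normed μ (x - t)) ⊆ Metric.closedBall x ρ.rOut := by
    intro t ht
    have ht' : x - t ∈ Function.support (ρ.normed μ) := ht
    rw [ContDiffBump.support_normed_eq, mem_ball_zero_iff] at ht'
    rw [Metric.mem_closedBall, dist_comm, dist_eq_norm]
    exact ht'.le
  exact
    { smooth := ρ.contDiff_normed.comp (contDiff_const.sub contDiff_id)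
      compact_support :=
        HasCompactSupport.of_support_subset_isCompact (isCompact_closedBall _ _) hsub
      support_subset := (closure_minimal hsub Metric.isClosed_closedBall).trans hU }

-- Convolving `h` with bump functions gives nonnegative numbers that converge to `h` a.e.
theorem ae_nonneg_of_forall_test {U : Set F} (hU : IsOpen U) {h : F → ℝ}
    (hh : IntegrableOn h U μ)
    (H : ∀ ψ, IsTest U ψ → (∀ s, 0 ≤ ψ s) → 0 ≤ ∫ s in U, h s * ψ s ∂μ) :
    ∀ᵐ s ∂(μ.restrict U), 0 ≤ h s := by
  rw [ae_restrict_iff' hU.measurableSet]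
  let ρ (n : ℕ) : ContDiffBump (0 : F) :=
    ⟨1 / (n + 1), 2 * (1 / (n + 1)), by positivity, lt_two_mul_self (by positivity)⟩
  have hρ : Tendsto (fun n => (ρ n).rOut) atTop (𝓝 0) := by
    simpa only [mul_zero] using (tendsto_one_div_add_atTop_nhds_zero_nat (𝕜 := ℝ)).const_mul 2
  filter_upwards [ContDiffBump.ae_convolution_tendsto_right_of_locallyIntegrable (μ := μ) (K := 2)
    hρ (Eventually.of_forall fun n => le_rfl)
    (hh.integrable_indicator hU.measurableSet).locallyIntegrable] with x hx hxU
  rw [indicator_of_mem hxU] at hx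
  obtain ⟨ε, hε, hball⟩ := Metric.isOpen_iff.1 hU x hxU
  refine ge_of_tendsto hx ?_
  filter_upwards [hρ.eventually (gt_mem_nhds hε)] with n hn
  have htest := isTest_normed_contDiffBump_const_sub (μ := μ) (ρ n)
    ((Metric.closedBall_subset_ball hn).trans hball)
  rw [convolution_lsmul_swap]
  refine (H _ htest fun s => (ρ n).nonneg_normed _).trans_eq ?_
  rw [← integral_indicator hU.measurableSet]
  congr 1 with t
  by_cases ht : t ∈ U <;> simp [ht, mul_comm]

theorem exists_isTest_integral_eq_one {U : Set F} (hU : IsOpen U) (hne : U.Nonempty) :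
    ∃ η, IsTest U η ∧ ∫ t, η t ∂μ = 1 := by
  obtain ⟨x, hx⟩ := hne
  obtain ⟨ε, hε, hball⟩ := Metric.isOpen_iff.1 hU x hx
  let ρ : ContDiffBump (0 : F) := ⟨ε / 3, ε / 2, by positivity, by linarith⟩
  refine ⟨fun t => ρ.normed μ (x - t), isTest_normed_contDiffBump_const_sub ρ
    ((Metric.closedBall_subset_ball (half_lt_self hε)).trans hball), ?_⟩
  rw [integral_sub_left_eq_self (ρ.normed μ) μ x]
  exact ρ.integral_normed

end Nonneg

theorem integrable_mul_comp_of_hasCompactSupport {X Y : Type*} [TopologicalSpace X]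
    [MeasurableSpace X] [OpensMeasurableSpace X] [TopologicalSpace Y] {μ : Measure X} {h : X → ℝ}
    {g : X → Y} {f : Y → ℝ} (hh : Integrable h μ) (hg : Continuous g) (hf : Continuous f)
    (hc : HasCompactSupport f) : Integrable (fun x => h x * f (g x)) μ := by
  obtain ⟨C, hC⟩ := hc.exists_bound_of_continuous hf
  exact hh.mul_bdd (c := C) (hf.comp hg).aestronglyMeasurable (Eventually.of_forall fun x => hC _)

theorem integrable_mul_of_hasCompactSupport {X : Type*} [TopologicalSpace X] [MeasurableSpace X]
    [OpensMeasurableSpace X] {μ : Measure X} {h f : X → ℝ} (hh : Integrable h μ)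
    (hf : Continuous f) (hc : HasCompactSupport f) : Integrable (fun x => h x * f x) μ :=
  integrable_mul_comp_of_hasCompactSupport hh continuous_id hf hc

section OneDim

variable {a b : ℝ} {H W Z : ℝ → ℝ}

theorem IsTest.exists_deriv_eq {q : ℝ → ℝ} (hq : IsTest (Ioo a b) q) (hq0 : ∫ t, q t = 0) :
    ∃ θ, IsTest (Ioo a b) θ ∧ deriv θ = q := by
  rcases (tsupport q).eq_empty_or_nonempty with hempty | hne
  · rw [tsupport_eq_empty_iff] at hempty
    exact ⟨q, hq, by simp [hempty]⟩
  set c := sInf (tsupport q)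
  set d := sSup (tsupport q)
  have hcd : tsupport q ⊆ Icc c d := subset_Icc_csInf_csSup
    hq.compact_support.isCompact.bddBelow hq.compact_support.isCompact.bddAbove
  have hc : a < c := (hq.support_subset (hq.compact_support.isCompact.sInf_mem hne)).1
  have hd : d < b := (hq.support_subset (hq.compact_support.isCompact.sSup_mem hne)).2
  have hqc (s : ℝ) (hs : s ∉ Icc c d) : q s = 0 := image_eq_zero_of_notMem_tsupport (hs <| hcd ·)
  let θ : ℝ → ℝ := fun t => ∫ s in a..t, q s
  have hθ (t : ℝ) : HasDerivAt θ (q t) t :=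
    (hq.smooth.continuous.integral_hasStrictDerivAt a t).hasDerivAt
  have hθ' : deriv θ = q := funext fun t => (hθ t).deriv
  have hsupp : Function.support θ ⊆ Icc c d := by
    refine Function.support_subset_iff'.2 fun t ht => ?_
    rcases not_and_or.1 ht with htc | htd
    · refine intervalIntegral.integral_zero_ae
        (Eventually.of_forall fun s hs => hqc s fun hs' => ?_)
      rcases le_max_iff.1 hs.2 with h | h <;> linarith [hs'.1]
    · refine (intervalIntegral.integral_eq_integral_of_support_subset ?_).trans hq0
      exact fun s hs => ⟨hc.trans_le (hcd (subset_tsupport q hs)).1,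
        (hcd (subset_tsupport q hs)).2.trans (not_le.1 htd).le⟩
  refine ⟨θ, ?_, hθ'⟩
  exact
    { smooth := contDiff_infty_iff_deriv.2
        ⟨fun t => (hθ t).differentiableAt, hθ'.symm ▸ hq.smooth⟩
      compact_support := HasCompactSupport.of_support_subset_isCompact isCompact_Icc hsupp
      support_subset := (closure_minimal hsupp isClosed_Icc).trans (Icc_subset_Ioo hc hd) }

-- Du Bois-Reymond: the derivatives of test functions are the test functions of mean zero.
theorem exists_ae_eq_const_of_integral_mul_deriv_eq_zero (hab : a < b)
    (hH : IntegrableOn H (Ioo a b))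
    (h : ∀ ψ, IsTest (Ioo a b) ψ → ∫ t in Ioo a b, H t * deriv ψ t = 0) :
    ∃ k, ∀ᵐ t ∂(volume.restrict (Ioo a b)), H t = k := by
  obtain ⟨η, hη, hη1⟩ := exists_isTest_integral_eq_one (μ := volume) isOpen_Ioo
    (nonempty_Ioo.2 hab)
  have hint {ψ : ℝ → ℝ} (hψ : IsTest (Ioo a b) ψ) : IntegrableOn (fun t => H t * ψ t) (Ioo a b) :=
    integrable_mul_of_hasCompactSupport hH hψ.smooth.continuous hψ.compact_support
  have hint' {ψ : ℝ → ℝ} (hψ : IsTest (Ioo a b) ψ) : Integrable ψ :=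
    hψ.smooth.continuous.integrable_of_hasCompactSupport hψ.compact_support
  set k := ∫ t in Ioo a b, H t * η t
  have hzero : ∀ᵐ t, t ∈ Ioo a b → H t - k = 0 := by
    refine isOpen_Ioo.ae_eq_zero_of_integral_contDiff_smul_eq_zero
      (hH.sub (integrableOn_const (by simp))).locallyIntegrableOn fun ψ hψs hψc hψU => ?_
    have hψ : IsTest (Ioo a b) ψ := ⟨hψs, hψc, hψU⟩
    set c := ∫ t, ψ t
    obtain ⟨θ, hθ, hθ'⟩ := (hψ.sub (hη.const_mul c)).exists_deriv_eq (by
      rw [integral_sub (hint' hψ) ((hint' hη).const_mul c), integral_const_mul, hη1, mul_one,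
        sub_self])
    have hc : ∫ t in Ioo a b, ψ t = c :=
      setIntegral_eq_integral_of_forall_compl_eq_zero fun t ht => hψ.eq_zero ht
    rw [← setIntegral_eq_integral_of_forall_compl_eq_zero
      fun t ht => by rw [hψ.eq_zero ht, zero_smul]]
    calc ∫ t in Ioo a b, ψ t • (H t - k)
        = ∫ t in Ioo a b, (H t * ψ t - k * ψ t) := by
          simp only [smul_eq_mul, mul_sub, mul_comm]
      _ = (∫ t in Ioo a b, H t * ψ t) - c * k := by
          rw [integral_sub (hint hψ) ((hint' hψ).integrableOn.const_mul k), integral_const_mul, hc,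
            mul_comm k]
      _ = ∫ t in Ioo a b, (H t * ψ t - c * (H t * η t)) := by
          rw [integral_sub (hint hψ) ((hint hη).const_mul c), integral_const_mul]
      _ = ∫ t in Ioo a b, H t * deriv θ t := by
          simp only [hθ', mul_sub, mul_left_comm]
      _ = 0 := h θ hθ
  refine ⟨k, ?_⟩
  rw [ae_restrict_iff' measurableSet_Ioo]
  filter_upwards [hzero] with t ht htI using sub_eq_zero.1 (ht htI)

theorem IsTest.integral_primitive_mul_deriv {ψ : ℝ → ℝ} (hψ : IsTest (Ioo a b) ψ) (hab : a ≤ b)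
    (hZ : IntegrableOn Z (Ioo a b)) :
    ∫ t in Ioo a b, (∫ s in a..t, Z s) * deriv ψ t = -∫ t in Ioo a b, Z t * ψ t := by
  have hZi : IntervalIntegrable Z volume a b := by
    rwa [intervalIntegrable_iff_integrableOn_Ioo_of_le hab]
  have parts := (hZi.absolutelyContinuousOnInterval_intervalIntegral
    left_mem_uIcc).integral_mul_deriv_eq_deriv_mul
      (hψ.smooth.of_le (by simp)).contDiffOn.absolutelyContinuousOnInterval
  have hIoo (f : ℝ → ℝ) : ∫ t in a..b, f t = ∫ t in Ioo a b, f t := by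
    rw [intervalIntegral.integral_of_le hab, integral_Ioc_eq_integral_Ioo]
  rw [hψ.eq_zero (by simp : a ∉ Ioo a b), hψ.eq_zero (by simp : b ∉ Ioo a b), mul_zero, mul_zero,
    sub_zero, zero_sub] at parts
  rw [← hIoo, parts, ← hIoo]
  congr 1
  refine intervalIntegral.integral_congr_ae ?_
  filter_upwards [hZi.ae_hasDerivAt_integral] with t ht htI
  rw [(ht (uIoc_subset_uIcc htI) a left_mem_uIcc).deriv]

theorem eq_add_integral_of_weakDeriv (hab : a < b) (hW : ContinuousOn W (Icc a b))
    (hZ : IntegrableOn Z (Ioo a b))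
    (h : ∀ ψ, IsTest (Ioo a b) ψ →
      ∫ t in Ioo a b, W t * deriv ψ t = -∫ t in Ioo a b, Z t * ψ t) :
    ∀ t ∈ Icc a b, W t = W a + ∫ s in a..t, Z s := by
  have hZi : IntervalIntegrable Z volume a b := by
    rwa [intervalIntegrable_iff_integrableOn_Ioo_of_le hab.le]
  set F : ℝ → ℝ := fun t => ∫ s in a..t, Z s
  have hF : ContinuousOn F (Icc a b) := by
    simpa only [uIcc_of_le hab.le] using
      (hZi.absolutelyContinuousOnInterval_intervalIntegral left_mem_uIcc).continuousOn
  have hint {P : ℝ → ℝ} (hP : ContinuousOn P (Icc a b)) : IntegrableOn P (Ioo a b) :=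
    hP.integrableOn_Icc.mono_set Ioo_subset_Icc_self
  have hWF : ContinuousOn (fun t => W t - F t) (Icc a b) := hW.sub hF
  obtain ⟨k, hk⟩ := exists_ae_eq_const_of_integral_mul_deriv_eq_zero hab (hint hWF) fun ψ hψ => by
    have hmul {P : ℝ → ℝ} (hP : ContinuousOn P (Icc a b)) :
        IntegrableOn (fun t => P t * deriv ψ t) (Ioo a b) :=
      hint (hP.mul (hψ.smooth.continuous_deriv (by simp)).continuousOn)
    simp only [sub_mul]
    rw [integral_sub (hmul hW) (hmul hF), h ψ hψ, hψ.integral_primitive_mul_deriv hab.le hZ,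
      sub_self]
  have hconst : EqOn (fun t => W t - F t) (fun _ => k) (Icc a b) :=
    Measure.eqOn_Icc_of_ae_eq volume hab.ne (by rwa [← restrict_Ioo_eq_restrict_Icc]) hWF
      continuousOn_const
  intro t ht
  have hat : W t - F t = W a - F a := (hconst ht).trans (hconst (left_mem_Icc.2 hab.le)).symm
  have hFa : F a = 0 := intervalIntegral.integral_same
  linarith

end OneDim

section Tensor

variable {E F : Type*} [NormedAddCommGroup E] [NormedSpace ℝ E] [NormedAddCommGroup F]
  [NormedSpace ℝ F] {U : Set E} {V : Set F} {φ : E → ℝ} {ψ : F → ℝ}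

theorem IsTest.tensor (hφ : IsTest U φ) (hψ : IsTest V ψ) :
    IsTest (U ×ˢ V) (fun z => φ z.1 * ψ z.2) := by
  have hsub : Function.support (fun z : E × F => φ z.1 * ψ z.2) ⊆ tsupport φ ×ˢ tsupport ψ :=
    fun z hz => ⟨subset_tsupport _ (left_ne_zero_of_mul hz),
      subset_tsupport _ (right_ne_zero_of_mul hz)⟩
  exact
    { smooth := (hφ.smooth.comp contDiff_fst).mul (hψ.smooth.comp contDiff_snd)
      compact_support := HasCompactSupport.of_support_subset_isCompact
        (hφ.compact_support.isCompact.prod hψ.compact_support.isCompact) hsub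
      support_subset := (closure_minimal hsub
        ((isClosed_tsupport _).prod (isClosed_tsupport _))).trans
        (prod_mono hφ.support_subset hψ.support_subset) }

theorem IsTest.deriv {U : Set ℝ} {ψ : ℝ → ℝ} (hψ : IsTest U ψ) : IsTest U (deriv ψ) where
  smooth := (contDiff_infty_iff_deriv.1 hψ.smooth).2
  compact_support := hψ.compact_support.deriv
  support_subset := (closure_minimal (support_deriv_subset (f := ψ)) (isClosed_tsupport _)).trans
    hψ.support_subset

end Tensor

section Cylinder

variable {N : ℕ} {Ω : Set (Space N)} {T : ℝ} {u : Space N × ℝ → ℝ}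

theorem cyl_subset : cyl Ω T ⊆ closure Ω ×ˢ Icc 0 T :=
  prod_mono subset_closure Ioo_subset_Icc_self

theorem measurableSet_cyl (hΩ : MeasurableSet Ω) (T : ℝ) : MeasurableSet (cyl Ω T) :=
  hΩ.prod measurableSet_Ioo

theorem muCyl_mono {τ : ℝ} (hτ : τ ≤ T) : muCyl Ω τ ≤ muCyl Ω T :=
  Measure.restrict_mono (prod_mono le_rfl (Ioo_subset_Ioo_right hτ)) le_rfl

theorem muTime_mono {τ : ℝ} (hτ : τ ≤ T) : muTime τ ≤ muTime T :=
  Measure.restrict_mono (Ioo_subset_Ioo_right hτ) le_rfl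

theorem intervalIntegral_eq_integral_muTime (hT : 0 ≤ T) (h : ℝ → ℝ) :
    ∫ t in (0 : ℝ)..T, h t = ∫ t, h t ∂(muTime T) := by
  rw [intervalIntegral.integral_of_le hT, integral_Ioc_eq_integral_Ioo, muTime]

theorem continuousOn_time (hu : ContinuousOn u (closure Ω ×ˢ Icc 0 T)) {x : Space N}
    (hx : x ∈ Ω) : ContinuousOn (fun t => u (x, t)) (Icc 0 T) :=
  hu.comp (by fun_prop) fun _ ht => ⟨subset_closure hx, ht⟩

theorem continuousOn_space (hu : ContinuousOn u (closure Ω ×ˢ Icc 0 T)) {t : ℝ}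
    (ht : t ∈ Icc 0 T) : ContinuousOn (fun x => u (x, t)) Ω :=
  hu.comp (by fun_prop) fun _ hx => ⟨subset_closure hx, ht⟩

theorem aestronglyMeasurable_slice (hΩ : MeasurableSet Ω)
    (hu : ContinuousOn u (closure Ω ×ˢ Icc 0 T)) {t : ℝ} (ht : t ∈ Icc 0 T) :
    AEStronglyMeasurable (fun x => u (x, t)) (muSpace Ω) :=
  (continuousOn_space hu ht).aestronglyMeasurable hΩ

theorem aestronglyMeasurable_cyl (hΩ : MeasurableSet Ω)
    (hu : ContinuousOn u (closure Ω ×ˢ Icc 0 T)) : AEStronglyMeasurable u (muCyl Ω T) :=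
  (hu.mono cyl_subset).aestronglyMeasurable (measurableSet_cyl hΩ T)

theorem exists_bound_of_continuousOn_closure (hΩb : Bornology.IsBounded Ω)
    (hu : ContinuousOn u (closure Ω ×ˢ Icc 0 T)) :
    ∃ B, ∀ z ∈ closure Ω ×ˢ Icc 0 T, ‖u z‖ ≤ B :=
  (hΩb.isCompact_closure.prod isCompact_Icc).exists_bound_of_continuousOn hu

theorem integrable_slice_of_continuousOn (hΩ : MeasurableSet Ω) (hΩb : Bornology.IsBounded Ω)
    (hu : ContinuousOn u (closure Ω ×ˢ Icc 0 T)) {t : ℝ} (ht : t ∈ Icc 0 T) :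
    Integrable (fun x => u (x, t)) (muSpace Ω) := by
  have := isFiniteMeasure_muSpace hΩb
  obtain ⟨B, hB⟩ := exists_bound_of_continuousOn_closure hΩb hu
  refine Integrable.of_bound (aestronglyMeasurable_slice hΩ hu ht) B ?_
  filter_upwards [self_mem_ae_restrict hΩ] with x hx using hB _ ⟨subset_closure hx, ht⟩

theorem integrable_cyl_of_continuousOn (hΩ : MeasurableSet Ω) (hΩb : Bornology.IsBounded Ω)
    (hu : ContinuousOn u (closure Ω ×ˢ Icc 0 T)) : Integrable u (muCyl Ω T) := by
  have := isFiniteMeasure_muCyl hΩb T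
  obtain ⟨B, hB⟩ := exists_bound_of_continuousOn_closure hΩb hu
  refine Integrable.of_bound (aestronglyMeasurable_cyl hΩ hu) B ?_
  filter_upwards [self_mem_ae_restrict (measurableSet_cyl hΩ T)] with z hz using
    hB z (cyl_subset hz)

theorem integrable_cyl_mul_of_continuousOn (hΩ : MeasurableSet Ω) (hΩb : Bornology.IsBounded Ω)
    (hu : ContinuousOn u (closure Ω ×ˢ Icc 0 T)) {h : Space N × ℝ → ℝ}
    (hh : Integrable h (muCyl Ω T)) : Integrable (fun z => h z * u z) (muCyl Ω T) := by
  obtain ⟨B, hB⟩ := exists_bound_of_continuousOn_closure hΩb hu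
  refine hh.mul_bdd (c := B) (aestronglyMeasurable_cyl hΩ hu) ?_
  filter_upwards [self_mem_ae_restrict (measurableSet_cyl hΩ T)] with z hz using
    hB z (cyl_subset hz)

theorem continuousOn_integral_slice (hΩ : MeasurableSet Ω) (hΩb : Bornology.IsBounded Ω)
    (hu : ContinuousOn u (closure Ω ×ˢ Icc 0 T)) :
    ContinuousOn (fun t => ∫ x, u (x, t) ∂(muSpace Ω)) (Icc 0 T) := by
  have := isFiniteMeasure_muSpace hΩb
  obtain ⟨B, hB⟩ := exists_bound_of_continuousOn_closure hΩb hu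
  refine continuousOn_of_dominated (bound := fun _ => B)
    (fun t ht => aestronglyMeasurable_slice hΩ hu ht) (fun t ht => ?_) (integrable_const _) ?_
  · filter_upwards [self_mem_ae_restrict hΩ] with x hx using hB _ ⟨subset_closure hx, ht⟩
  · filter_upwards [self_mem_ae_restrict hΩ] with x hx using continuousOn_time hu hx

end Cylinder

theorem sq_sub_sq_eq_integral_of_eq_add_integral {a b : ℝ} (hab : a ≤ b) {F Z : ℝ → ℝ}
    (hZ : IntervalIntegrable Z volume a b)
    (hF : ∀ t ∈ Icc a b, F t = F a + ∫ s in a..t, Z s) :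
    F b ^ 2 - F a ^ 2 = 2 * ∫ t in a..b, Z t * F t := by
  set P : ℝ → ℝ := fun t => F a + ∫ s in a..t, Z s
  have hP : AbsolutelyContinuousOnInterval P a b :=
    (LipschitzWith.const (F a)).lipschitzOnWith.absolutelyContinuousOnInterval.add
      (hZ.absolutelyContinuousOnInterval_intervalIntegral left_mem_uIcc)
  have hFP {t : ℝ} (ht : t ∈ Icc a b) : F t = P t := hF t ht
  calc F b ^ 2 - F a ^ 2 = P b * P b - P a * P a := by
        rw [hFP (right_mem_Icc.2 hab), hFP (left_mem_Icc.2 hab), sq, sq]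
    _ = ∫ t in a..b, (deriv P t * P t + P t * deriv P t) :=
        (hP.integral_deriv_mul_eq_sub hP).symm
    _ = ∫ t in a..b, 2 * (Z t * F t) := by
        refine intervalIntegral.integral_congr_ae ?_
        filter_upwards [hZ.ae_hasDerivAt_integral] with t ht htI
        have hd : deriv P t = Z t :=
          ((ht (uIoc_subset_uIcc htI) a left_mem_uIcc).const_add _).deriv
        rw [uIoc_of_le hab] at htI
        rw [hd, hFP (Ioc_subset_Icc_self htI)]
        ring
    _ = 2 * ∫ t in a..b, Z t * F t := intervalIntegral.integral_const_mul _ _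

section WeakTimeDeriv

variable {N : ℕ} {Ω : Set (Space N)} {T : ℝ} {u ut : Space N × ℝ → ℝ}

theorem integral_muCyl_mul_comp_snd {h : Space N × ℝ → ℝ} (hh : Integrable h (muCyl Ω T))
    {ψ : ℝ → ℝ} (hψ : IsTest (Ioo 0 T) ψ) :
    ∫ z, h z * ψ z.2 ∂(muCyl Ω T) = ∫ t in Ioo 0 T, (∫ x, h (x, t) ∂(muSpace Ω)) * ψ t := by
  have hint := integrable_mul_comp_of_hasCompactSupport hh continuous_snd hψ.smooth.continuous
    hψ.compact_support
  rw [muCyl_eq_prod] at hint ⊢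
  rw [integral_prod_symm _ hint]
  simp only [integral_mul_const]
  rfl

theorem IsTest.integrable_mul_comp_fst {φ : Space N → ℝ} (hφ : IsTest Ω φ)
    {h : Space N × ℝ → ℝ} (hh : Integrable h (muCyl Ω T)) :
    Integrable (fun z => h z * φ z.1) (muCyl Ω T) :=
  integrable_mul_comp_of_hasCompactSupport hh continuous_fst hφ.smooth.continuous
    hφ.compact_support

theorem HasWeakTimeDeriv.integral_integral_mul_deriv (hw : HasWeakTimeDeriv Ω T u ut)
    (hu : Integrable u (muCyl Ω T)) (hut : Integrable ut (muCyl Ω T)) {φ : Space N → ℝ}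
    {ψ : ℝ → ℝ} (hφ : IsTest Ω φ) (hψ : IsTest (Ioo 0 T) ψ) :
    ∫ t in Ioo 0 T, (∫ x, u (x, t) * φ x ∂(muSpace Ω)) * deriv ψ t =
      -∫ t in Ioo 0 T, (∫ x, ut (x, t) * φ x ∂(muSpace Ω)) * ψ t := by
  have hd (z : Space N × ℝ) : deriv (fun t => φ z.1 * ψ t) z.2 = φ z.1 * deriv ψ z.2 :=
    deriv_const_mul _ (hψ.differentiable _)
  have := hw _ (hφ.tensor hψ)
  simp only [hd, ← mul_assoc] at this
  rwa [integral_muCyl_mul_comp_snd (hφ.integrable_mul_comp_fst hu) hψ.deriv,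
    integral_muCyl_mul_comp_snd (hφ.integrable_mul_comp_fst hut) hψ] at this

theorem integrable_muSpace_intervalIntegral (hT : 0 ≤ T) {h : Space N × ℝ → ℝ}
    (hh : Integrable h (muCyl Ω T)) :
    Integrable (fun x => ∫ s in (0 : ℝ)..T, h (x, s)) (muSpace Ω) := by
  simp only [intervalIntegral_eq_integral_muTime hT]
  rw [muCyl_eq_prod] at hh
  exact hh.integral_prod_left

theorem intervalIntegral_integral_swap (hT : 0 ≤ T) {h : Space N × ℝ → ℝ}
    (hh : Integrable h (muCyl Ω T)) :
    ∫ s in (0 : ℝ)..T, ∫ x, h (x, s) ∂(muSpace Ω) =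
      ∫ x, (∫ s in (0 : ℝ)..T, h (x, s)) ∂(muSpace Ω) := by
  simp only [intervalIntegral_eq_integral_muTime hT]
  rw [muCyl_eq_prod] at hh
  rw [← integral_prod_symm _ hh, integral_prod _ hh]

variable (hΩ : IsOpen Ω) (hΩb : Bornology.IsBounded Ω) (hT : 0 < T)
  (hu : ContinuousOn u (closure Ω ×ˢ Icc 0 T)) (hut : Integrable ut (muCyl Ω T))
  (hw : HasWeakTimeDeriv Ω T u ut)
include hΩ hΩb hT hu hut hw

theorem HasWeakTimeDeriv.integral_mul_test_eq_add {t : ℝ} (ht : t ∈ Icc 0 T) {φ : Space N → ℝ}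
    (hφ : IsTest Ω φ) :
    ∫ x, u (x, t) * φ x ∂(muSpace Ω) = ∫ x, u (x, 0) * φ x ∂(muSpace Ω) +
      ∫ x, (∫ s in (0 : ℝ)..t, ut (x, s)) * φ x ∂(muSpace Ω) := by
  have hφc : Continuous (fun z : Space N × ℝ => φ z.1) := hφ.smooth.continuous.comp continuous_fst
  have hZ : Integrable (fun z => ut z * φ z.1) (muCyl Ω T) := hφ.integrable_mul_comp_fst hut
  have hZ' := hZ
  rw [muCyl_eq_prod] at hZ'
  have hW : ContinuousOn (fun s => ∫ x, u (x, s) * φ x ∂(muSpace Ω)) (Icc 0 T) :=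
    continuousOn_integral_slice hΩ.measurableSet hΩb (hu.mul hφc.continuousOn)
  rw [eq_add_integral_of_weakDeriv hT hW hZ'.integral_prod_right
    (fun ψ hψ => hw.integral_integral_mul_deriv
      (integrable_cyl_of_continuousOn hΩ.measurableSet hΩb hu) hut hφ hψ) t ht,
    intervalIntegral_integral_swap ht.1 (hZ.mono_measure (muCyl_mono ht.2))]
  simp only [intervalIntegral.integral_mul_const]

theorem HasWeakTimeDeriv.ae_eq_add_integral_of_mem {t : ℝ} (ht : t ∈ Icc 0 T) :
    ∀ᵐ x ∂(muSpace Ω), u (x, t) = u (x, 0) + ∫ s in (0 : ℝ)..t, ut (x, s) := by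
  set I : Space N → ℝ := fun x => ∫ s in (0 : ℝ)..t, ut (x, s)
  have hIi : Integrable I (muSpace Ω) :=
    integrable_muSpace_intervalIntegral ht.1 (hut.mono_measure (muCyl_mono ht.2))
  have hslice {s : ℝ} (hs : s ∈ Icc 0 T) : Integrable (fun x => u (x, s)) (muSpace Ω) :=
    integrable_slice_of_continuousOn hΩ.measurableSet hΩb hu hs
  have h0 : (0 : ℝ) ∈ Icc 0 T := left_mem_Icc.2 hT.le
  have hzero : ∀ᵐ x, x ∈ Ω → u (x, t) - u (x, 0) - I x = 0 := by
    refine hΩ.ae_eq_zero_of_integral_contDiff_smul_eq_zero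
      (IntegrableOn.locallyIntegrableOn (((hslice ht).sub (hslice h0)).sub hIi))
      fun φ hφs hφc hφU => ?_
    have hφ : IsTest Ω φ := ⟨hφs, hφc, hφU⟩
    have hmul {h : Space N → ℝ} (hh : Integrable h (muSpace Ω)) :
        Integrable (fun x => h x * φ x) (muSpace Ω) :=
      integrable_mul_of_hasCompactSupport hh hφs.continuous hφc
    rw [← setIntegral_eq_integral_of_forall_compl_eq_zero
      fun x hx => by rw [hφ.eq_zero hx, zero_smul]]
    calc ∫ x, φ x • (u (x, t) - u (x, 0) - I x) ∂(muSpace Ω)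
        = ∫ x, (u (x, t) * φ x - u (x, 0) * φ x - I x * φ x) ∂(muSpace Ω) := by
          simp only [smul_eq_mul, mul_comm (φ _), sub_mul]
      _ = 0 := by
          rw [integral_sub (by exact (hmul (hslice ht)).sub (hmul (hslice h0))) (hmul hIi),
            integral_sub (hmul (hslice ht)) (hmul (hslice h0)),
            hw.integral_mul_test_eq_add hΩ hΩb hT hu hut ht hφ, add_sub_cancel_left, sub_self]
  rw [muSpace, ae_restrict_iff' hΩ.measurableSet]
  filter_upwards [hzero] with x hx hxΩ
  linarith [hx hxΩ]

theorem HasWeakTimeDeriv.ae_forall_eq_add_integral :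
    ∀ᵐ x ∂(muSpace Ω), IntervalIntegrable (fun t => ut (x, t)) volume 0 T ∧
      ∀ t ∈ Icc 0 T, u (x, t) = u (x, 0) + ∫ s in (0 : ℝ)..t, ut (x, s) := by
  have hut' := hut
  rw [muCyl_eq_prod] at hut'
  obtain ⟨D, hDT, hDc, hD⟩ := (TopologicalSpace.IsSeparable.of_separableSpace
    (Icc (0 : ℝ) T)).exists_countable_dense_subset
  have hall : ∀ᵐ x ∂(muSpace Ω), ∀ t ∈ D,
      u (x, t) = u (x, 0) + ∫ s in (0 : ℝ)..t, ut (x, s) :=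
    (ae_ball_iff hDc).2 fun t ht => hw.ae_eq_add_integral_of_mem hΩ hΩb hT hu hut (hDT ht)
  filter_upwards [hut'.prod_right_ae, hall, self_mem_ae_restrict hΩ.measurableSet] with x hx hxD hxΩ
  have hxi : IntervalIntegrable (fun t => ut (x, t)) volume 0 T := by
    rwa [intervalIntegrable_iff_integrableOn_Ioo_of_le hT.le]
  have hcont := (hxi.absolutelyContinuousOnInterval_intervalIntegral
    (c := 0) left_mem_uIcc).continuousOn
  rw [uIcc_of_le hT.le] at hcont
  exact ⟨hxi, EqOn.of_subset_closure hxD (continuousOn_time hu hxΩ)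
    (continuousOn_const.add hcont) hDT hD⟩

theorem HasWeakTimeDeriv.integral_sq_sub_integral_sq {τ : ℝ} (hτ : τ ∈ Icc 0 T) :
    ∫ x, u (x, τ) ^ 2 ∂(muSpace Ω) - ∫ x, u (x, 0) ^ 2 ∂(muSpace Ω) =
      2 * ∫ z, ut z * u z ∂(muCyl Ω τ) := by
  have hsq {t : ℝ} (ht : t ∈ Icc 0 T) : Integrable (fun x => u (x, t) ^ 2) (muSpace Ω) :=
    integrable_slice_of_continuousOn hΩ.measurableSet hΩb (hu.pow 2) ht
  have hint : Integrable (fun z => ut z * u z) (muCyl Ω τ) :=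
    (integrable_cyl_mul_of_continuousOn hΩ.measurableSet hΩb hu hut).mono_measure
      (muCyl_mono hτ.2)
  rw [muCyl_eq_prod] at hint
  rw [← integral_sub (hsq hτ) (hsq (left_mem_Icc.2 hT.le)), muCyl_eq_prod,
    integral_prod _ hint, ← integral_const_mul]
  refine integral_congr_ae ?_
  filter_upwards [hw.ae_forall_eq_add_integral hΩ hΩb hT hu hut] with x ⟨hxi, hx⟩
  have hsub : uIcc 0 τ ⊆ uIcc 0 T := by
    rw [uIcc_of_le hτ.1, uIcc_of_le hT.le]; exact Icc_subset_Icc_right hτ.2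
  change u (x, τ) ^ 2 - u (x, 0) ^ 2 = 2 * ∫ t, ut (x, t) * u (x, t) ∂(muTime τ)
  rw [sq_sub_sq_eq_integral_of_eq_add_integral (F := fun t => u (x, t)) hτ.1
    (hxi.mono_set hsub) fun t ht => hx t (Icc_subset_Icc_right hτ.2 ht),
    intervalIntegral_eq_integral_muTime hτ.1]

end WeakTimeDeriv

section Slices

variable {N : ℕ} {Ω : Set (Space N)} {T : ℝ} {E : Type*} [NormedAddCommGroup E]

theorem memLp_slice_time {h : Space N × ℝ → E} (hh : MemLp h 2 (muCyl Ω T)) :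
    ∀ᵐ t ∂(muTime T), MemLp (fun x => h (x, t)) 2 (muSpace Ω) := by
  have hsq := (memLp_two_iff_integrable_sq_norm hh.1).1 hh
  have hm := hh.1
  rw [muCyl_eq_prod] at hsq hm
  filter_upwards [hsq.prod_left_ae, hm.prodMk_right] with t hsqt hmt
  exact (memLp_two_iff_integrable_sq_norm hmt).2 hsqt

theorem ae_ae_slice_time {p : Space N × ℝ → Prop} (h : ∀ᵐ z ∂(muCyl Ω T), p z) :
    ∀ᵐ t ∂(muTime T), ∀ᵐ x ∂(muSpace Ω), p (x, t) := by
  rw [muCyl_eq_prod] at h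
  exact Measure.ae_ae_of_ae_prod (p := fun z : ℝ × Space N => p z.swap)
    (Measure.measurePreserving_swap.quasiMeasurePreserving.ae h)

theorem ae_norm_le_of_ae_ae {h : Space N × ℝ → E} (hh : AEStronglyMeasurable h (muCyl Ω T))
    {L : ℝ} (hL : ∀ᵐ t ∂(muTime T), ∀ᵐ x ∂(muSpace Ω), ‖h (x, t)‖ ≤ L) :
    ∀ᵐ z ∂(muCyl Ω T), ‖h z‖ ≤ L := by
  obtain ⟨k, hk, hhk⟩ := hh
  have hmeas : MeasurableSet {z | ‖k z‖ ≤ L} :=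
    measurableSet_le hk.norm.measurable measurable_const
  have hkL : ∀ᵐ z ∂(muCyl Ω T), ‖k z‖ ≤ L := by
    rw [muCyl_eq_prod, Measure.ae_prod_iff_ae_ae hmeas, Measure.ae_ae_comm hmeas]
    filter_upwards [ae_ae_slice_time hhk, hL] with t hkt hLt
    filter_upwards [hkt, hLt] with x hx hxL
    rwa [← hx]
  filter_upwards [hhk, hkL] with z hz hzL
  rwa [hz]

theorem abs_le_of_ae_ae {u : Space N × ℝ → ℝ} (hΩ : IsOpen Ω) (hT : 0 < T)
    (hu : ContinuousOn u (closure Ω ×ˢ Icc 0 T)) {K : ℝ}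
    (hK : ∀ᵐ t ∂(muTime T), ∀ᵐ x ∂(muSpace Ω), |u (x, t)| ≤ K) :
    ∀ x ∈ Ω, ∀ t ∈ Icc 0 T, |u (x, t)| ≤ K := by
  have hspace : ∀ᵐ t ∂(muTime T), ∀ x ∈ Ω, |u (x, t)| ≤ K := by
    filter_upwards [hK, self_mem_ae_restrict measurableSet_Ioo] with t hKt ht
    have : EqOn (fun x => max |u (x, t)| K) (fun _ => K) Ω := by
      refine Measure.eqOn_open_of_ae_eq (μ := volume) ?_ hΩ
        ((continuousOn_space hu (Ioo_subset_Icc_self ht)).abs.sup continuousOn_const)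
        continuousOn_const
      filter_upwards [hKt] with x hx using max_eq_right hx
    exact fun x hx => max_eq_right_iff.1 (this hx)
  intro x hx
  have : EqOn (fun t => max |u (x, t)| K) (fun _ => K) (Icc 0 T) := by
    refine Measure.eqOn_Icc_of_ae_eq volume hT.ne ?_
      ((continuousOn_time hu hx).abs.sup continuousOn_const) continuousOn_const
    rw [← restrict_Ioo_eq_restrict_Icc]
    filter_upwards [hspace] with t ht using max_eq_right (ht x hx)
  exact fun t ht => max_eq_right_iff.1 (this ht)

end Slices

section Coercive

variable {N : ℕ} {Ω : Set (Space N)} {T l : ℝ} {b : Space N × ℝ → Space N}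
  {c : Space N × ℝ → ℝ}

theorem IsTest.integrable_coercive (hΩb : Bornology.IsBounded Ω) (hb : MemLp b 2 (muCyl Ω T))
    (hc : Integrable c (muCyl Ω T)) (l : ℝ) {φ : Space N → ℝ} (hφ : IsTest Ω φ) :
    Integrable (fun z => (c z - l) * φ z.1 + 1 / 2 * inner ℝ (b z) (gradient φ z.1))
      (muCyl Ω T) := by
  have := isFiniteMeasure_muCyl hΩb T
  obtain ⟨A, hA⟩ := hφ.hasCompactSupport_gradient.exists_bound_of_continuous
    hφ.continuous_gradient
  have hgrad : MemLp (fun z : Space N × ℝ => gradient φ z.1) 2 (muCyl Ω T) :=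
    MemLp.of_bound (hφ.continuous_gradient.comp continuous_fst).aestronglyMeasurable A
      (Eventually.of_forall fun z => hA z.1)
  exact (hφ.integrable_mul_comp_fst (hc.sub (integrable_const l))).add
    ((integrable_inner_of_memLp hb hgrad).const_mul _)

theorem WeaklyCoercive.ae_nonneg_of_isTest (h : WeaklyCoercive Ω T l b c)
    (hΩb : Bornology.IsBounded Ω) (hb : MemLp b 2 (muCyl Ω T)) (hc : Integrable c (muCyl Ω T))
    {φ : Space N → ℝ} (hφ : IsTest Ω φ) (hφ0 : ∀ x, 0 ≤ φ x) :
    ∀ᵐ t ∂(muTime T), 0 ≤ ∫ x, ((c (x, t) - l) * φ x +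
      1 / 2 * inner ℝ (b (x, t)) (gradient φ x)) ∂(muSpace Ω) := by
  have := isFiniteMeasure_muCyl hΩb T
  have hint := hφ.integrable_coercive hΩb hb hc l
  have hint' := hint
  rw [muCyl_eq_prod] at hint'
  refine ae_nonneg_of_forall_test isOpen_Ioo hint'.integral_prod_right fun ψ hψ hψ0 => ?_
  have hgrad (z : Space N × ℝ) :
      gradient (fun y => φ y * ψ z.2) z.1 = ψ z.2 • gradient φ z.1 := by
    simp only [mul_comm (φ _), hφ.gradient_const_mul]
  have hφψ : Integrable (fun z : Space N × ℝ => l * (φ z.1 * ψ z.2)) (muCyl Ω T) :=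
    ((hφ.tensor hψ).smooth.continuous.integrable_of_hasCompactSupport
      (hφ.tensor hψ).compact_support).restrict.const_mul l
  have hcoer := h _ (hφ.tensor hψ) fun z => mul_nonneg (hφ0 _) (hψ0 _)
  have hsplit : ∫ z, (c z * (φ z.1 * ψ z.2) +
        1 / 2 * inner ℝ (b z) (gradient (fun y => φ y * ψ z.2) z.1)) ∂(muCyl Ω T) =
      ∫ z, ((c z - l) * φ z.1 + 1 / 2 * inner ℝ (b z) (gradient φ z.1)) * ψ z.2 ∂(muCyl Ω T) +
        l * ∫ z, φ z.1 * ψ z.2 ∂(muCyl Ω T) := by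
    rw [← integral_const_mul, ← integral_add (integrable_mul_comp_of_hasCompactSupport hint
      continuous_snd hψ.smooth.continuous hψ.compact_support) hφψ]
    refine integral_congr_ae (Eventually.of_forall fun z => ?_)
    simp only [hgrad, inner_smul_right]
    ring
  rw [hsplit, integral_muCyl_mul_comp_snd hint hψ] at hcoer
  exact le_of_add_le_add_right (by rwa [zero_add])

/-- The `L²` classes of `(φ, ∇φ)` for nonnegative test functions `φ`. -/
def nonnegTestPairs {N : ℕ} (Ω : Set (Space N)) :
    Set (Lp ℝ 2 (muSpace Ω) × Lp (Space N) 2 (muSpace Ω)) :=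
  {p | ∃ (φ : Space N → ℝ) (hφ : IsTest Ω φ), (∀ x, 0 ≤ φ x) ∧
    p = ((hφ.memLp 2).toLp φ, (hφ.memLp_gradient 2).toLp (gradient φ))}

theorem HasNonnegH10Gradient.toLp_mem_closure {v : Space N → ℝ} {G : Space N → Space N}
    (hv : HasNonnegH10Gradient Ω v G) :
    (hv.memLp.toLp v, hv.memLp_grad.toLp G) ∈ closure (nonnegTestPairs Ω) := by
  obtain ⟨φ, hφ, hφv, hφG⟩ := hv.approx
  refine mem_closure_of_tendsto (b := atTop) (f := fun n =>
    (((hφ n).1.memLp 2).toLp (φ n), ((hφ n).1.memLp_gradient 2).toLp (gradient (φ n))))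
    (Tendsto.prodMk_nhds ?_ ?_) (Eventually.of_forall fun n => ⟨φ n, (hφ n).1, (hφ n).2, rfl⟩)
  · exact (Lp.tendsto_Lp_iff_tendsto_eLpNorm'' _ (fun n => (hφ n).1.memLp 2) _ _).2 hφv
  · exact (Lp.tendsto_Lp_iff_tendsto_eLpNorm'' _ (fun n => (hφ n).1.memLp_gradient 2) _ _).2 hφG

theorem exists_countable_dense_nonneg_test (Ω : Set (Space N)) :
    ∃ S : Set (Space N → ℝ), S.Countable ∧ (∀ φ ∈ S, IsTest Ω φ ∧ ∀ x, 0 ≤ φ x) ∧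
      ∀ v G, HasNonnegH10Gradient Ω v G → ∃ φ : ℕ → Space N → ℝ, (∀ n, φ n ∈ S) ∧
        Tendsto (fun n => eLpNorm (fun x => φ n x - v x) 2 (muSpace Ω)) atTop (𝓝 0) ∧
        Tendsto (fun n => eLpNorm (fun x => gradient (φ n) x - G x) 2 (muSpace Ω))
          atTop (𝓝 0) := by
  have : Fact ((2 : ℝ≥0∞) ≠ ⊤) := ⟨ENNReal.ofNat_ne_top⟩
  obtain ⟨D, hDS, hDc, hD⟩ := (TopologicalSpace.IsSeparable.of_separableSpace
    (nonnegTestPairs Ω)).exists_countable_dense_subset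
  choose! Φ hΦ hΦ0 hΦD using fun p (hp : p ∈ D) => hDS hp
  refine ⟨Φ '' D, hDc.image Φ, forall_mem_image.2 fun p hp => ⟨hΦ p hp, hΦ0 p hp⟩, fun v G hv => ?_⟩
  obtain ⟨p, hpD, hp⟩ := mem_closure_iff_seq_limit.1
    (closure_minimal hD isClosed_closure hv.toLp_mem_closure)
  refine ⟨fun n => Φ (p n), fun n => mem_image_of_mem Φ (hpD n), ?_, ?_⟩
  · refine (Lp.tendsto_Lp_iff_tendsto_eLpNorm'' _ (fun n => (hΦ _ (hpD n)).memLp 2) _ hv.memLp).1 ?_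
    exact ((continuous_fst.tendsto _).comp hp).congr fun n => congrArg Prod.fst (hΦD _ (hpD n))
  · refine (Lp.tendsto_Lp_iff_tendsto_eLpNorm'' _ (fun n => (hΦ _ (hpD n)).memLp_gradient 2) _
      hv.memLp_grad).1 ?_
    exact ((continuous_snd.tendsto _).comp hp).congr fun n => congrArg Prod.snd (hΦD _ (hpD n))

theorem integral_coercive_eq {β : Space N → Space N} {γ v : Space N → ℝ} {G : Space N → Space N}
    (hβ : MemLp β 2 (muSpace Ω)) (hγ : MemLp γ 2 (muSpace Ω)) (hv : MemLp v 2 (muSpace Ω))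
    (hG : MemLp G 2 (muSpace Ω)) :
    ∫ x, (γ x * v x + 1 / 2 * inner ℝ (β x) (G x)) ∂(muSpace Ω) =
      ∫ x, inner ℝ (v x) (γ x) ∂(muSpace Ω) +
        1 / 2 * ∫ x, inner ℝ (G x) (β x) ∂(muSpace Ω) := by
  rw [← integral_const_mul, ← integral_add (integrable_inner_of_memLp hv hγ)
    ((integrable_inner_of_memLp hG hβ).const_mul _)]
  congr 1 with x
  rw [real_inner_comm (G x)]
  rfl

/- The weak formulation only tests one function for a.e. `t`; a countable dense family makes the
null set of times uniform. -/
theorem WeaklyCoercive.ae_nonneg (h : WeaklyCoercive Ω T l b c) (hΩb : Bornology.IsBounded Ω)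
    (hb : MemLp b 2 (muCyl Ω T)) (hc : MemLp c 2 (muCyl Ω T)) :
    ∀ᵐ t ∂(muTime T), ∀ v G, HasNonnegH10Gradient Ω v G →
      0 ≤ ∫ x, ((c (x, t) - l) * v x + 1 / 2 * inner ℝ (b (x, t)) (G x)) ∂(muSpace Ω) := by
  have := isFiniteMeasure_muSpace hΩb
  have := isFiniteMeasure_muCyl hΩb T
  obtain ⟨S, hSc, hS, hdense⟩ := exists_countable_dense_nonneg_test Ω
  have htest := (ae_ball_iff hSc).2 fun φ hφ =>
    h.ae_nonneg_of_isTest hΩb hb (hc.integrable one_le_two) (hS φ hφ).1 (hS φ hφ).2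
  filter_upwards [htest, memLp_slice_time hb, memLp_slice_time hc] with t ht hbt hct v G hv
  have hcl : MemLp (fun x => c (x, t) - l) 2 (muSpace Ω) := hct.sub (memLp_const l)
  obtain ⟨φ, hφS, hφv, hφG⟩ := hdense v G hv
  have hφ (n : ℕ) : IsTest Ω (φ n) := (hS _ (hφS n)).1
  rw [integral_coercive_eq hbt hcl hv.memLp hv.memLp_grad]
  refine ge_of_tendsto' ((tendsto_integral_inner_of_tendsto_eLpNorm (fun n => (hφ n).memLp 2)
    hv.memLp hcl hφv).add ((tendsto_integral_inner_of_tendsto_eLpNorm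
      (fun n => (hφ n).memLp_gradient 2) hv.memLp_grad hbt hφG).const_mul (1 / 2))) fun n => ?_
  rw [← integral_coercive_eq hbt hcl ((hφ n).memLp 2) ((hφ n).memLp_gradient 2)]
  exact ht _ (hφS n)

end Coercive

section Gronwall

variable {T A a : ℝ} {y : ℝ → ℝ}

theorem antitoneOn_exp_neg_mul_add_integral (ha : 0 ≤ a) (hT : 0 ≤ T)
    (hy : ContinuousOn y (Icc 0 T))
    (h : ∀ t ∈ Icc 0 T, y t ≤ A + a * ∫ s in (0 : ℝ)..t, y s) :
    AntitoneOn (fun t => Real.exp (-(a * t)) * (A + a * ∫ s in (0 : ℝ)..t, y s)) (Icc 0 T) := by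
  set Y : ℝ → ℝ := fun t => ∫ s in (0 : ℝ)..t, y s
  have hyi {t : ℝ} (ht : t ∈ Icc 0 T) : IntervalIntegrable y volume 0 t :=
    (hy.mono (by rw [uIcc_of_le ht.1]; exact Icc_subset_Icc_right ht.2)).intervalIntegrable
  have hYc : ContinuousOn Y (Icc 0 T) := by
    simpa only [uIcc_of_le hT] using intervalIntegral.continuousOn_primitive_interval'
      (hyi (right_mem_Icc.2 hT)) left_mem_uIcc
  have hderiv {t : ℝ} (ht : t ∈ Ioo 0 T) :
      HasDerivAt (fun t => Real.exp (-(a * t)) * (A + a * Y t))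
        (Real.exp (-(a * t)) * a * (y t - (A + a * Y t))) t := by
    have hY : HasDerivAt Y (y t) t :=
      intervalIntegral.integral_hasDerivAt_right (hyi (Ioo_subset_Icc_self ht))
        ((hy.mono Ioo_subset_Icc_self).stronglyMeasurableAtFilter isOpen_Ioo t ht)
        (hy.continuousAt (Icc_mem_nhds ht.1 ht.2))
    have hexp : HasDerivAt (fun t => Real.exp (-(a * t))) (Real.exp (-(a * t)) * (-(a * 1))) t :=
      ((hasDerivAt_id t).const_mul a).neg.exp
    refine (hexp.mul ((hY.const_mul a).const_add A)).congr_deriv ?_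
    ring
  refine antitoneOn_of_deriv_nonpos (convex_Icc 0 T)
    (ContinuousOn.mul (by fun_prop) (continuousOn_const.add (continuousOn_const.mul hYc))) ?_ ?_
  · rw [interior_Icc]
    exact fun t ht => (hderiv ht).differentiableAt.differentiableWithinAt
  · rw [interior_Icc]
    intro t ht
    rw [(hderiv ht).deriv]
    exact mul_nonpos_of_nonneg_of_nonpos (by positivity)
      (sub_nonpos.2 (h t (Ioo_subset_Icc_self ht)))

theorem le_mul_exp_of_le_add_integral (ha : 0 ≤ a) (hy : ContinuousOn y (Icc 0 T))
    (h : ∀ t ∈ Icc 0 T, y t ≤ A + a * ∫ s in (0 : ℝ)..t, y s) :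
    ∀ t ∈ Icc 0 T, y t ≤ A * Real.exp (a * t) := by
  intro t ht
  have hT : 0 ≤ T := ht.1.trans ht.2
  have hanti := antitoneOn_exp_neg_mul_add_integral ha hT hy h (left_mem_Icc.2 hT) ht ht.1
  simp only [intervalIntegral.integral_same, mul_zero, neg_zero, Real.exp_zero, one_mul,
    add_zero] at hanti
  calc y t ≤ A + a * ∫ s in (0 : ℝ)..t, y s := h t ht
    _ = Real.exp (-(a * t)) * (A + a * ∫ s in (0 : ℝ)..t, y s) * Real.exp (a * t) := by
        rw [mul_right_comm, ← Real.exp_add, neg_add_cancel, Real.exp_zero, one_mul]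
    _ ≤ A * Real.exp (a * t) := by gcongr

end Gronwall

section Residual

variable {N : ℕ} {Ω : Set (Space N)} {T K L l τ : ℝ}
  {b : Space N × ℝ → Space N} {c f u u₁ u₂ v : Space N × ℝ → ℝ}
  {Du Du₁ Du₂ : Space N × ℝ → Space N}

/-- `u ∈ L^∞(0, T; W_0^{1,∞}(Ω)) ∩ C(closure of Q_T)` with spatial gradient `Du`, and both `u` and
`Du` are bounded by `K`. -/
structure HasBoundedGradient {N : ℕ} (Ω : Set (Space N)) (T K : ℝ) (u : Space N × ℝ → ℝ)
    (Du : Space N × ℝ → Space N) : Prop where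
  continuousOn : ContinuousOn u (closure Ω ×ˢ Icc 0 T)
  grad_memLp : MemLp Du ∞ (muCyl Ω T)
  grad : ∀ᵐ t ∂(muTime T), HasH10Gradient Ω (fun x => u (x, t)) (fun x => Du (x, t))
  abs_le : ∀ x ∈ Ω, ∀ t ∈ Icc 0 T, |u (x, t)| ≤ K
  norm_grad_le : ∀ᵐ z ∂(muCyl Ω T), ‖Du z‖ ≤ K

theorem HasBoundedGradient.sub {K₁ K₂ : ℝ} (h₁ : HasBoundedGradient Ω T K₁ u₁ Du₁)
    (h₂ : HasBoundedGradient Ω T K₂ u₂ Du₂) :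
    HasBoundedGradient Ω T (K₁ + K₂) (fun z => u₁ z - u₂ z) (fun z => Du₁ z - Du₂ z) where
  continuousOn := h₁.continuousOn.sub h₂.continuousOn
  grad_memLp := h₁.grad_memLp.sub h₂.grad_memLp
  grad := by filter_upwards [h₁.grad, h₂.grad] with t ht₁ ht₂ using ht₁.sub ht₂
  abs_le x hx t ht := (abs_sub _ _).trans (add_le_add (h₁.abs_le x hx t ht) (h₂.abs_le x hx t ht))
  norm_grad_le := by
    filter_upwards [h₁.norm_grad_le, h₂.norm_grad_le] with z hz₁ hz₂
    exact (norm_sub_le _ _).trans (add_le_add hz₁ hz₂)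

theorem HasBoundedGradient.ae_abs_le (h : HasBoundedGradient Ω T K u Du) (hΩ : MeasurableSet Ω) :
    ∀ᵐ z ∂(muCyl Ω T), |u z| ≤ K := by
  filter_upwards [self_mem_ae_restrict (measurableSet_cyl hΩ T)] with z hz
  exact h.abs_le z.1 hz.1 z.2 (Ioo_subset_Icc_self hz.2)

/-- The lower order part `b · ∇u + c u - f` of the equation. -/
noncomputable def lowerOrder {N : ℕ} (b : Space N × ℝ → Space N) (c f u : Space N × ℝ → ℝ)
    (Du : Space N × ℝ → Space N) (z : Space N × ℝ) : ℝ :=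
  inner ℝ (b z) (Du z) + c z * u z - f z

/-- The residual `∂_t u + b · ∇u + c u - f` of the equation. -/
noncomputable def residual {N : ℕ} (d : Data N) (u : Space N × ℝ → ℝ)
    (Du : Space N × ℝ → Space N) (ut : Space N × ℝ → ℝ) (z : Space N × ℝ) : ℝ :=
  ut z + lowerOrder d.b d.c d.f u Du z

/-- The sum of the norms of `b`, `c` and `f` in `L¹(Q_T)`. -/
noncomputable def coeffNorm {N : ℕ} (Ω : Set (Space N)) (T : ℝ) (b : Space N × ℝ → Space N)
    (c f : Space N × ℝ → ℝ) : ℝ :=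
  ∫ z, ‖b z‖ ∂(muCyl Ω T) + ∫ z, ‖c z‖ ∂(muCyl Ω T) + ∫ z, ‖f z‖ ∂(muCyl Ω T)

theorem integrable_inner_of_memLp_top {α E : Type*} [MeasurableSpace α] {μ : Measure α}
    [NormedAddCommGroup E] [InnerProductSpace ℝ E] {F G : α → E} (hF : Integrable F μ)
    (hG : MemLp G ∞ μ) : Integrable (fun z => inner ℝ (F z) (G z)) μ :=
  memLp_one_iff_integrable.1 ((memLp_one_iff_integrable.2 hF).of_bilin (fun a b => inner ℝ a b) 1
    hG (hF.1.inner hG.1) (Eventually.of_forall fun x => by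
      simpa using nnnorm_inner_le_nnnorm (𝕜 := ℝ) (F x) (G x)))

theorem HasBoundedGradient.integrable_lowerOrder (h : HasBoundedGradient Ω T K u Du)
    (hΩ : MeasurableSet Ω) (hΩb : Bornology.IsBounded Ω) (hb : Integrable b (muCyl Ω T))
    (hc : Integrable c (muCyl Ω T)) (hf : Integrable f (muCyl Ω T)) :
    Integrable (lowerOrder b c f u Du) (muCyl Ω T) :=
  ((integrable_inner_of_memLp_top hb h.grad_memLp).add
    (integrable_cyl_mul_of_continuousOn hΩ hΩb h.continuousOn hc)).sub hf

theorem abs_lowerOrder_le (hK : 1 ≤ K) {z : Space N × ℝ} (hu : |u z| ≤ K) (hDu : ‖Du z‖ ≤ K) :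
    |lowerOrder b c f u Du z| ≤ K * (‖b z‖ + ‖c z‖ + ‖f z‖) := by
  have hb : |inner ℝ (b z) (Du z)| ≤ ‖b z‖ * K := (abs_real_inner_le_norm _ _).trans (by gcongr)
  have hc : |c z * u z| ≤ ‖c z‖ * K := by rw [abs_mul, ← Real.norm_eq_abs (c z)]; gcongr
  have hf : ‖f z‖ ≤ ‖f z‖ * K := le_mul_of_one_le_right (norm_nonneg _) hK
  calc |lowerOrder b c f u Du z| ≤ |inner ℝ (b z) (Du z)| + |c z * u z| + ‖f z‖ :=
        (abs_sub _ _).trans (add_le_add_left (abs_add_le _ _) _)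
    _ ≤ K * (‖b z‖ + ‖c z‖ + ‖f z‖) := by linarith

theorem HasBoundedGradient.abs_integral_lowerOrder_mul_le (h : HasBoundedGradient Ω T K u Du)
    (hΩ : MeasurableSet Ω) (hK : 1 ≤ K) (hb : Integrable b (muCyl Ω T))
    (hc : Integrable c (muCyl Ω T)) (hf : Integrable f (muCyl Ω T)) (hL : 0 ≤ L)
    (hv : ∀ᵐ z ∂(muCyl Ω T), |v z| ≤ L) (hτ : τ ≤ T) :
    |∫ z, lowerOrder b c f u Du z * v z ∂(muCyl Ω τ)| ≤ K * L * coeffNorm Ω T b c f := by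
  have hbound : ∀ᵐ z ∂(muCyl Ω T),
      ‖lowerOrder b c f u Du z * v z‖ ≤ K * L * (‖b z‖ + ‖c z‖ + ‖f z‖) := by
    filter_upwards [h.ae_abs_le hΩ, h.norm_grad_le, hv] with z hz hDz hvz
    rw [norm_mul, mul_right_comm]
    exact mul_le_mul (abs_lowerOrder_le hK hz hDz) hvz (norm_nonneg _) (by positivity)
  have hbc : Integrable (fun z => ‖b z‖ + ‖c z‖) (muCyl Ω T) := hb.norm.add hc.norm
  have hint : Integrable (fun z => K * L * (‖b z‖ + ‖c z‖ + ‖f z‖)) (muCyl Ω T) :=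
    (hbc.add hf.norm).const_mul _
  calc |∫ z, lowerOrder b c f u Du z * v z ∂(muCyl Ω τ)|
      ≤ ∫ z, K * L * (‖b z‖ + ‖c z‖ + ‖f z‖) ∂(muCyl Ω τ) :=
        norm_integral_le_of_norm_le (hint.mono_measure (muCyl_mono hτ))
          (ae_mono (muCyl_mono hτ) hbound)
    _ ≤ ∫ z, K * L * (‖b z‖ + ‖c z‖ + ‖f z‖) ∂(muCyl Ω T) :=
        integral_mono_measure (muCyl_mono hτ)
          (Eventually.of_forall fun z => by positivity) hint
    _ = K * L * coeffNorm Ω T b c f := by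
        rw [integral_const_mul, integral_add hbc hf.norm, integral_add hb.norm hc.norm,
          coeffNorm]

theorem integral_muCyl_nonneg_of_ae_slice {h : Space N × ℝ → ℝ} (hh : Integrable h (muCyl Ω T))
    (hslice : ∀ᵐ t ∂(muTime T), 0 ≤ ∫ x, h (x, t) ∂(muSpace Ω)) (hτ : τ ≤ T) :
    0 ≤ ∫ z, h z ∂(muCyl Ω τ) := by
  have hhτ := hh.mono_measure (muCyl_mono hτ)
  rw [muCyl_eq_prod] at hhτ ⊢
  rw [integral_prod_symm _ hhτ]
  exact integral_nonneg_of_ae (ae_mono (muTime_mono hτ) hslice)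

/- `w²` is a nonnegative element of `H_0^1(Ω)` with gradient `2 w ∇w`, so that the coercivity
condition tested with it reads `∫ (b · ∇w + c w) w ≥ l ∫ w²`. -/
theorem WeaklyCoercive.mul_integral_sq_le (h : WeaklyCoercive Ω T l b c) (hΩ : MeasurableSet Ω)
    (hΩb : Bornology.IsBounded Ω) (hb : MemLp b 2 (muCyl Ω T)) (hc : MemLp c 2 (muCyl Ω T))
    (hu : HasBoundedGradient Ω T K u Du) (hτ : τ ≤ T) :
    l * ∫ z, u z ^ 2 ∂(muCyl Ω τ) ≤ ∫ z, lowerOrder b c 0 u Du z * u z ∂(muCyl Ω τ) := by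
  have := isFiniteMeasure_muCyl hΩb T
  have hlow : Integrable (fun z => lowerOrder b c 0 u Du z * u z) (muCyl Ω T) :=
    integrable_cyl_mul_of_continuousOn hΩ hΩb hu.continuousOn (hu.integrable_lowerOrder hΩ hΩb
      (hb.integrable one_le_two) (hc.integrable one_le_two) (integrable_zero _ _ _))
  have hsq : Integrable (fun z => l * u z ^ 2) (muCyl Ω T) :=
    (integrable_cyl_of_continuousOn hΩ hΩb (hu.continuousOn.pow 2)).const_mul l
  rw [← sub_nonneg, ← integral_const_mul, ← integral_sub
    (hlow.mono_measure (muCyl_mono hτ)) (hsq.mono_measure (muCyl_mono hτ))]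
  refine integral_muCyl_nonneg_of_ae_slice (hlow.sub hsq) ?_ hτ
  filter_upwards [h.ae_nonneg hΩb hb hc, hu.grad, ae_ae_slice_time (hu.ae_abs_le hΩ),
    ae_ae_slice_time hu.norm_grad_le] with t hcoer hgrad hle hDle
  refine (hcoer _ _ (hgrad.sq hle (L := K.toNNReal) ?_)).trans_eq ?_
  · filter_upwards [hDle] with x hx using hx.trans (Real.le_coe_toNNReal K)
  · congr 1 with x
    simp only [lowerOrder, inner_smul_right, Pi.zero_apply]
    ring

end Residual

section Energy

variable {N : ℕ} {Ω : Set (Space N)} {T K n m β τ : ℝ} {d d₁ d₂ : Data N}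
  {u u₁ u₂ ut ut₁ ut₂ v : Space N × ℝ → ℝ} {Du Du₁ Du₂ : Space N × ℝ → Space N}

/-- A solution for data with integrable coefficients of total norm at most `n` in `L¹(Q_T)`, such
that the solution and its spatial gradient are bounded by `K`. -/
structure IsBoundedSolution {N : ℕ} (Ω : Set (Space N)) (T K n : ℝ) (d : Data N)
    (u : Space N × ℝ → ℝ) (Du : Space N × ℝ → Space N) (ut : Space N × ℝ → ℝ) : Prop
    extends IsSolutionWith Ω T d u Du ut, HasBoundedGradient Ω T K u Du where
  integrable_b : Integrable d.b (muCyl Ω T)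
  integrable_c : Integrable d.c (muCyl Ω T)
  integrable_f : Integrable d.f (muCyl Ω T)
  coeffNorm_le : coeffNorm Ω T d.b d.c d.f ≤ n

theorem HasWeakTimeDeriv.sub (h₁ : HasWeakTimeDeriv Ω T u₁ ut₁) (h₂ : HasWeakTimeDeriv Ω T u₂ ut₂)
    (hu₁ : Integrable u₁ (muCyl Ω T)) (hu₂ : Integrable u₂ (muCyl Ω T))
    (hut₁ : Integrable ut₁ (muCyl Ω T)) (hut₂ : Integrable ut₂ (muCyl Ω T)) :
    HasWeakTimeDeriv Ω T (fun z => u₁ z - u₂ z) (fun z => ut₁ z - ut₂ z) := by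
  intro φ hφ
  have hd (z : Space N × ℝ) : deriv (fun t => φ (z.1, t)) z.2 = fderiv ℝ φ z (0, 1) :=
    ((hφ.differentiable z).hasFDerivAt.comp_hasDerivAt z.2
      ((hasDerivAt_const z.2 z.1).prodMk (hasDerivAt_id z.2))).deriv
  have hdφ {h : Space N × ℝ → ℝ} (hh : Integrable h (muCyl Ω T)) :
      Integrable (fun z => h z * fderiv ℝ φ z (0, 1)) (muCyl Ω T) :=
    integrable_mul_of_hasCompactSupport hh (hφ.continuous_fderiv.clm_apply continuous_const)
      (hφ.compact_support.fderiv_apply ℝ (0, 1))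
  have hmulφ {h : Space N × ℝ → ℝ} (hh : Integrable h (muCyl Ω T)) :
      Integrable (fun z => h z * φ z) (muCyl Ω T) :=
    integrable_mul_of_hasCompactSupport hh hφ.smooth.continuous hφ.compact_support
  have e₁ := h₁ φ hφ
  have e₂ := h₂ φ hφ
  simp only [hd] at e₁ e₂
  simp only [hd, sub_mul]
  rw [integral_sub (hdφ hu₁) (hdφ hu₂), integral_sub (hmulφ hut₁) (hmulφ hut₂), e₁, e₂]
  ring

theorem IsSolutionWith.integrable_deriv (h : IsSolutionWith Ω T d u Du ut)
    (hΩb : Bornology.IsBounded Ω) : Integrable ut (muCyl Ω T) := by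
  have := isFiniteMeasure_muCyl hΩb T
  exact h.deriv_memLp.integrable one_le_two

theorem smul_mem_gradConvex {γ₁ γ₂ v : Space N → ℝ} (hv : v ∈ gradConvex Ω γ₂) (hm : 0 < m)
    (hβ : 0 ≤ β) (hγ₁ : ∀ᵐ x ∂(muSpace Ω), m ≤ γ₁ x)
    (hγ : ∀ᵐ x ∂(muSpace Ω), |γ₁ x - γ₂ x| ≤ β) :
    (fun x => m / (m + β) * v x) ∈ gradConvex Ω γ₁ := by
  obtain ⟨G, hG, hGle⟩ := hv
  refine ⟨_, hG.const_mul (m / (m + β)), ?_⟩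
  filter_upwards [hGle, hγ₁, hγ] with x hGx hmx hβx
  have hGx' : ‖G x‖ ≤ γ₁ x + β := by linarith [(abs_le.1 hβx).1]
  rw [norm_smul, Real.norm_of_nonneg (by positivity), div_mul_eq_mul_div,
    div_le_iff₀ (by positivity)]
  calc m * ‖G x‖ ≤ m * (γ₁ x + β) := by gcongr
    _ ≤ γ₁ x * (m + β) := by linarith [mul_le_mul_of_nonneg_right hmx hβ]

namespace IsBoundedSolution

theorem integrable_residual (h : IsBoundedSolution Ω T K n d u Du ut) (hΩ : MeasurableSet Ω)
    (hΩb : Bornology.IsBounded Ω) : Integrable (residual d u Du ut) (muCyl Ω T) :=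
  (h.integrable_deriv hΩb).add (h.toHasBoundedGradient.integrable_lowerOrder hΩ hΩb
    h.integrable_b h.integrable_c h.integrable_f)

theorem ae_integral_residual_nonneg (h : IsBoundedSolution Ω T K n d u Du ut)
    (hΩ : MeasurableSet Ω) (hΩb : Bornology.IsBounded Ω)
    (hv : ContinuousOn v (closure Ω ×ˢ Icc 0 T))
    (hmem : ∀ᵐ t ∂(muTime T), (fun x => v (x, t)) ∈ gradConvex Ω (fun x => d.g (x, t))) :
    ∀ᵐ t ∂(muTime T),
      0 ≤ ∫ x, residual d u Du ut (x, t) * (v (x, t) - u (x, t)) ∂(muSpace Ω) := by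
  have hslice {k : Space N × ℝ → ℝ} (hk : Integrable k (muCyl Ω T)) : ∀ᵐ t ∂(muTime T),
      Integrable (fun x => k (x, t) * (v (x, t) - u (x, t))) (muSpace Ω) := by
    have := integrable_cyl_mul_of_continuousOn hΩ hΩb (hv.sub h.continuousOn) hk
    rw [muCyl_eq_prod] at this
    exact this.prod_left_ae
  filter_upwards [h.ineq, hmem, hslice (h.integrable_deriv hΩb),
    hslice (integrable_inner_of_memLp_top h.integrable_b h.grad_memLp),
    hslice (integrable_cyl_mul_of_continuousOn hΩ hΩb h.continuousOn h.integrable_c),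
    hslice h.integrable_f] with t ht hvt hut hb hc hf
  have hutb : Integrable (fun x => ut (x, t) * (v (x, t) - u (x, t)) +
      inner ℝ (d.b (x, t)) (Du (x, t)) * (v (x, t) - u (x, t))) (muSpace Ω) := hut.add hb
  refine (sub_nonneg.2 (ht _ hvt)).trans_eq ?_
  rw [← integral_add hut hb, ← integral_add hutb hc, ← integral_sub (by exact hutb.add hc) hf]
  congr 1 with x
  simp only [residual, lowerOrder]
  ring

theorem integral_residual_mul_scaled_nonneg (h₁ : IsBoundedSolution Ω T K n d₁ u₁ Du₁ ut₁)
    (h₂ : IsSolutionWith Ω T d₂ u₂ Du₂ ut₂) (hΩ : MeasurableSet Ω)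
    (hΩb : Bornology.IsBounded Ω) (hm : 0 < m) (hβ : 0 ≤ β)
    (hg₁ : ∀ᵐ z ∂(muCyl Ω T), m ≤ d₁.g z)
    (hg : ∀ᵐ z ∂(muCyl Ω T), |d₁.g z - d₂.g z| ≤ β) (hτ : τ ≤ T) :
    0 ≤ ∫ z, residual d₁ u₁ Du₁ ut₁ z * (m / (m + β) * u₂ z - u₁ z) ∂(muCyl Ω τ) := by
  have hv : ContinuousOn (fun z => m / (m + β) * u₂ z) (closure Ω ×ˢ Icc 0 T) :=
    continuousOn_const.mul h₂.continuousOn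
  refine integral_muCyl_nonneg_of_ae_slice (integrable_cyl_mul_of_continuousOn hΩ hΩb
    (hv.sub h₁.continuousOn) (h₁.integrable_residual hΩ hΩb))
    (h₁.ae_integral_residual_nonneg hΩ hΩb hv ?_) hτ
  filter_upwards [h₂.mem_convex, ae_ae_slice_time hg₁, ae_ae_slice_time hg] with t hu₂ hm₁ hβt
  exact smul_mem_gradConvex hu₂ hm hβ hm₁ hβt

theorem integral_sq_le (h : IsBoundedSolution Ω T K n d u Du ut) (hΩ : MeasurableSet Ω)
    (hΩb : Bornology.IsBounded Ω) {t : ℝ} (ht : t ∈ Icc 0 T) :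
    ∫ x, u (x, t) ^ 2 ∂(muSpace Ω) ≤ K ^ 2 * (muSpace Ω).real univ := by
  have := isFiniteMeasure_muSpace hΩb
  refine (Real.le_norm_self _).trans (norm_integral_le_of_norm_le_const ?_)
  filter_upwards [self_mem_ae_restrict hΩ] with x hx
  rw [norm_pow]
  exact pow_le_pow_left₀ (norm_nonneg _) (h.abs_le x hx t ht) 2

theorem integrable_deriv_mul (h : IsBoundedSolution Ω T K n d u Du ut) (hΩ : MeasurableSet Ω)
    (hΩb : Bornology.IsBounded Ω) (hv : ContinuousOn v (closure Ω ×ˢ Icc 0 T)) (hτ : τ ≤ T) :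
    Integrable (fun z => ut z * v z) (muCyl Ω τ) :=
  (integrable_cyl_mul_of_continuousOn hΩ hΩb hv (h.integrable_deriv hΩb)).mono_measure
    (muCyl_mono hτ)

theorem integrable_residual_mul (h : IsBoundedSolution Ω T K n d u Du ut) (hΩ : MeasurableSet Ω)
    (hΩb : Bornology.IsBounded Ω) (hv : ContinuousOn v (closure Ω ×ˢ Icc 0 T)) (hτ : τ ≤ T) :
    Integrable (fun z => residual d u Du ut z * v z) (muCyl Ω τ) :=
  (integrable_cyl_mul_of_continuousOn hΩ hΩb hv (h.integrable_residual hΩ hΩb)).mono_measure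
    (muCyl_mono hτ)

theorem neg_le_integral_residual_mul_self (h : IsBoundedSolution Ω T K n d u Du ut)
    (hΩ : IsOpen Ω) (hΩb : Bornology.IsBounded Ω) (hT : 0 < T) (hK : 1 ≤ K) (hτ : τ ∈ Icc 0 T) :
    -(K ^ 2 * ((muSpace Ω).real univ / 2 + n)) ≤
      ∫ z, residual d u Du ut z * u z ∂(muCyl Ω τ) := by
  have hΩm := hΩ.measurableSet
  have hu := h.toHasBoundedGradient
  have hut := h.integrable_deriv hΩb
  have henergy := h.weakDeriv.integral_sq_sub_integral_sq hΩ hΩb hT h.continuousOn hut hτ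
  have hτ0 : 0 ≤ ∫ x, u (x, τ) ^ 2 ∂(muSpace Ω) := integral_nonneg fun x => sq_nonneg _
  have h0 := h.integral_sq_le hΩm hΩb (left_mem_Icc.2 hT.le)
  have hlow := (_root_.abs_le.1 (hu.abs_integral_lowerOrder_mul_le hΩm hK h.integrable_b
    h.integrable_c h.integrable_f (by positivity) (hu.ae_abs_le hΩm) hτ.2)).1
  have hn : K * K * coeffNorm Ω T d.b d.c d.f ≤ K * K * n := by gcongr; exact h.coeffNorm_le
  have hsplit : ∫ z, residual d u Du ut z * u z ∂(muCyl Ω τ) =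
      ∫ z, ut z * u z ∂(muCyl Ω τ) +
        ∫ z, lowerOrder d.b d.c d.f u Du z * u z ∂(muCyl Ω τ) := by
    rw [← integral_add (h.integrable_deriv_mul hΩm hΩb h.continuousOn hτ.2)
      ((integrable_cyl_mul_of_continuousOn hΩm hΩb h.continuousOn (hu.integrable_lowerOrder hΩm hΩb
        h.integrable_b h.integrable_c h.integrable_f)).mono_measure (muCyl_mono hτ.2))]
    simp only [residual, add_mul]
  rw [hsplit]
  linarith

end IsBoundedSolution

end Energy

section Stability

variable {N : ℕ} {Ω : Set (Space N)} {T K n l m β τ : ℝ} {d₁ d₂ : Data N}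
  {u₁ u₂ ut₁ ut₂ : Space N × ℝ → ℝ} {Du₁ Du₂ : Space N × ℝ → Space N}

theorem integral_muCyl_eq_intervalIntegral {h : Space N × ℝ → ℝ} (hτ : 0 ≤ τ)
    (hh : Integrable h (muCyl Ω τ)) :
    ∫ z, h z ∂(muCyl Ω τ) = ∫ t in (0 : ℝ)..τ, ∫ x, h (x, t) ∂(muSpace Ω) := by
  rw [intervalIntegral_eq_integral_muTime hτ]
  rw [muCyl_eq_prod] at hh ⊢
  exact integral_prod_symm _ hh

/- `res₁ - res₂ = ∂_t w + (b₁ · ∇w + c₁ w) + ((b₁ - b₂) · ∇u₂ + (c₁ - c₂) u₂ - (f₁ - f₂))` with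
`w = u₁ - u₂`. -/
theorem residual_sub_residual_mul_sub (z : Space N × ℝ) :
    (residual d₁ u₁ Du₁ ut₁ z - residual d₂ u₂ Du₂ ut₂ z) * (u₁ z - u₂ z) =
      (ut₁ z - ut₂ z) * (u₁ z - u₂ z) +
        lowerOrder d₁.b d₁.c 0 (fun y => u₁ y - u₂ y) (fun y => Du₁ y - Du₂ y) z *
          (u₁ z - u₂ z) +
        lowerOrder (d₁.b - d₂.b) (d₁.c - d₂.c) (d₁.f - d₂.f) u₂ Du₂ z * (u₁ z - u₂ z) := by
  simp only [residual, lowerOrder, Pi.sub_apply, Pi.zero_apply, inner_sub_left, inner_sub_right]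
  ring

/-- The constant of the stability estimate for solutions bounded by `K` together with their
gradients; `V` is the volume of `Ω` and `n` bounds the coefficients in `L¹(Q_T)`. -/
noncomputable def stabilityConst (T l m K n V : ℝ) : ℝ :=
  (1 + 4 * K ^ 2 + 4 * K ^ 2 * (V / 2 + n) / m) * Real.exp (2 * |l| * T)

theorem stabilityConst_pos {V : ℝ} (hm : 0 < m) (hn : 0 ≤ n) (hV : 0 ≤ V) :
    0 < stabilityConst T l m K n V := by
  unfold stabilityConst
  positivity

theorem coeffNorm_nonneg (b : Space N × ℝ → Space N) (c f : Space N × ℝ → ℝ) :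
    0 ≤ coeffNorm Ω T b c f := by
  unfold coeffNorm
  positivity

variable (hΩ : IsOpen Ω) (hΩb : Bornology.IsBounded Ω) (hT : 0 < T) (hK : 1 ≤ K)
  (h₁ : IsBoundedSolution Ω T K n d₁ u₁ Du₁ ut₁) (h₂ : IsBoundedSolution Ω T K n d₂ u₂ Du₂ ut₂)
  (hτ : τ ∈ Icc 0 T)
include hΩ hΩb hT hK h₁ h₂ hτ

/- Adding the inequality for `u₁` tested with `λ u₂` and the one for `u₂` tested with `λ u₁`, where
`λ = m / (m + β)`, leaves only the error `(β / m) (∫ res₁ u₁ + ∫ res₂ u₂)`. -/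
theorem integral_residual_sub_mul_sub_le (hm : 0 < m) (hβ : 0 ≤ β)
    (hg₁ : ∀ᵐ z ∂(muCyl Ω T), m ≤ d₁.g z) (hg₂ : ∀ᵐ z ∂(muCyl Ω T), m ≤ d₂.g z)
    (hg : ∀ᵐ z ∂(muCyl Ω T), |d₁.g z - d₂.g z| ≤ β) :
    ∫ z, (residual d₁ u₁ Du₁ ut₁ z - residual d₂ u₂ Du₂ ut₂ z) * (u₁ z - u₂ z) ∂(muCyl Ω τ) ≤
      β * (2 * K ^ 2 * ((muSpace Ω).real univ / 2 + n) / m) := by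
  have hΩm := hΩ.measurableSet
  have hg' : ∀ᵐ z ∂(muCyl Ω T), |d₂.g z - d₁.g z| ≤ β := by simpa only [abs_sub_comm] using hg
  have i₁₁ := h₁.integrable_residual_mul hΩm hΩb h₁.continuousOn hτ.2
  have i₁₂ := h₁.integrable_residual_mul hΩm hΩb h₂.continuousOn hτ.2
  have i₂₁ := h₂.integrable_residual_mul hΩm hΩb h₁.continuousOn hτ.2
  have i₂₂ := h₂.integrable_residual_mul hΩm hΩb h₂.continuousOn hτ.2
  have t₁ := h₁.integral_residual_mul_scaled_nonneg h₂.toIsSolutionWith hΩm hΩb hm hβ hg₁ hg hτ.2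
  have t₂ := h₂.integral_residual_mul_scaled_nonneg h₁.toIsSolutionWith hΩm hΩb hm hβ hg₂ hg' hτ.2
  have r₁ := h₁.neg_le_integral_residual_mul_self hΩ hΩb hT hK hτ
  have r₂ := h₂.neg_le_integral_residual_mul_self hΩ hΩb hT hK hτ
  simp only [mul_sub, mul_left_comm _ (m / (m + β))] at t₁ t₂
  rw [integral_sub (i₁₂.const_mul _) i₁₁, integral_const_mul] at t₁
  rw [integral_sub (i₂₁.const_mul _) i₂₂, integral_const_mul] at t₂
  simp only [sub_mul, mul_sub]
  rw [integral_sub (by exact i₁₁.sub i₂₁) (by exact i₁₂.sub i₂₂), integral_sub i₁₁ i₂₁,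
    integral_sub i₁₂ i₂₂]
  set I₁₁ := ∫ z, residual d₁ u₁ Du₁ ut₁ z * u₁ z ∂(muCyl Ω τ)
  set I₁₂ := ∫ z, residual d₁ u₁ Du₁ ut₁ z * u₂ z ∂(muCyl Ω τ)
  set I₂₁ := ∫ z, residual d₂ u₂ Du₂ ut₂ z * u₁ z ∂(muCyl Ω τ)
  set I₂₂ := ∫ z, residual d₂ u₂ Du₂ ut₂ z * u₂ z ∂(muCyl Ω τ)
  have hdiag : (m + β) * (I₁₁ + I₂₂) ≤ m * (I₁₂ + I₂₁) := by
    have : I₁₁ + I₂₂ ≤ m * (I₁₂ + I₂₁) / (m + β) := by linear_combination t₁ + t₂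
    rwa [le_div_iff₀ (by positivity), mul_comm] at this
  rw [← mul_div_assoc, le_div_iff₀ hm]
  linarith [mul_le_mul_of_nonneg_left (add_le_add r₁ r₂) hβ]

theorem integral_sq_sub_le_integral_residual (hb : MemLp d₁.b 2 (muCyl Ω T))
    (hc : MemLp d₁.c 2 (muCyl Ω T)) (hl : WeaklyCoercive Ω T l d₁.b d₁.c) :
    (∫ x, (u₁ (x, τ) - u₂ (x, τ)) ^ 2 ∂(muSpace Ω) -
        ∫ x, (u₁ (x, 0) - u₂ (x, 0)) ^ 2 ∂(muSpace Ω)) / 2 +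
        l * (∫ s in (0 : ℝ)..τ, ∫ x, (u₁ (x, s) - u₂ (x, s)) ^ 2 ∂(muSpace Ω)) -
        2 * K ^ 2 * coeffNorm Ω T (d₁.b - d₂.b) (d₁.c - d₂.c) (d₁.f - d₂.f) ≤
      ∫ z, (residual d₁ u₁ Du₁ ut₁ z - residual d₂ u₂ Du₂ ut₂ z) * (u₁ z - u₂ z)
        ∂(muCyl Ω τ) := by
  have hΩm := hΩ.measurableSet
  have hw := h₁.toHasBoundedGradient.sub h₂.toHasBoundedGradient
  have hu₁ := integrable_cyl_of_continuousOn hΩm hΩb h₁.continuousOn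
  have hu₂ := integrable_cyl_of_continuousOn hΩm hΩb h₂.continuousOn
  have hut₁ := h₁.integrable_deriv hΩb
  have hut₂ := h₂.integrable_deriv hΩb
  have hut : Integrable (fun z => ut₁ z - ut₂ z) (muCyl Ω T) := hut₁.sub hut₂
  have hmul {h : Space N × ℝ → ℝ} (hh : Integrable h (muCyl Ω T)) :
      Integrable (fun z => h z * (u₁ z - u₂ z)) (muCyl Ω τ) :=
    (integrable_cyl_mul_of_continuousOn hΩm hΩb hw.continuousOn hh).mono_measure (muCyl_mono hτ.2)
  have henergy := (h₁.weakDeriv.sub h₂.weakDeriv hu₁ hu₂ hut₁ hut₂).integral_sq_sub_integral_sq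
    hΩ hΩb hT hw.continuousOn hut hτ
  have hsq : Integrable (fun z => (u₁ z - u₂ z) ^ 2) (muCyl Ω τ) :=
    (integrable_cyl_of_continuousOn hΩm hΩb (hw.continuousOn.pow 2)).mono_measure (muCyl_mono hτ.2)
  have hcoer := hl.mul_integral_sq_le hΩm hΩb hb hc hw hτ.2
  rw [integral_muCyl_eq_intervalIntegral hτ.1 hsq] at hcoer
  have hdiff := (abs_le.1 (h₂.toHasBoundedGradient.abs_integral_lowerOrder_mul_le hΩm hK
    (h₁.integrable_b.sub h₂.integrable_b) (h₁.integrable_c.sub h₂.integrable_c)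
    (h₁.integrable_f.sub h₂.integrable_f) (by linarith) (hw.ae_abs_le hΩm) hτ.2)).1
  have htime := hmul hut
  have hlow := hmul (hw.integrable_lowerOrder hΩm hΩb h₁.integrable_b h₁.integrable_c
    (integrable_zero _ _ _))
  have hlow₂ := hmul (h₂.toHasBoundedGradient.integrable_lowerOrder hΩm hΩb
    (h₁.integrable_b.sub h₂.integrable_b) (h₁.integrable_c.sub h₂.integrable_c)
    (h₁.integrable_f.sub h₂.integrable_f))
  simp only [residual_sub_residual_mul_sub]
  rw [integral_add (by exact htime.add hlow) hlow₂, integral_add htime hlow]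
  linarith

variable (hb : MemLp d₁.b 2 (muCyl Ω T)) (hc : MemLp d₁.c 2 (muCyl Ω T))
  (hl : WeaklyCoercive Ω T l d₁.b d₁.c) (hm : 0 < m) (hβ : 0 ≤ β)
  (hg₁ : ∀ᵐ z ∂(muCyl Ω T), m ≤ d₁.g z) (hg₂ : ∀ᵐ z ∂(muCyl Ω T), m ≤ d₂.g z)
  (hg : ∀ᵐ z ∂(muCyl Ω T), |d₁.g z - d₂.g z| ≤ β)
include hb hc hl hm hβ hg₁ hg₂ hg

theorem integral_sq_sub_le_add_intervalIntegral :
    ∫ x, (u₁ (x, τ) - u₂ (x, τ)) ^ 2 ∂(muSpace Ω) ≤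
      ∫ x, (u₁ (x, 0) - u₂ (x, 0)) ^ 2 ∂(muSpace Ω) +
        4 * K ^ 2 * coeffNorm Ω T (d₁.b - d₂.b) (d₁.c - d₂.c) (d₁.f - d₂.f) +
        4 * K ^ 2 * ((muSpace Ω).real univ / 2 + n) / m * β +
        2 * |l| * ∫ s in (0 : ℝ)..τ, ∫ x, (u₁ (x, s) - u₂ (x, s)) ^ 2 ∂(muSpace Ω) := by
  have hlower := integral_sq_sub_le_integral_residual hΩ hΩb hT hK h₁ h₂ hτ hb hc hl
  have hupper := integral_residual_sub_mul_sub_le hΩ hΩb hT hK h₁ h₂ hτ hm hβ hg₁ hg₂ hg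
  have hnonneg : 0 ≤ ∫ s in (0 : ℝ)..τ, ∫ x, (u₁ (x, s) - u₂ (x, s)) ^ 2 ∂(muSpace Ω) :=
    intervalIntegral.integral_nonneg hτ.1 fun _ _ => integral_nonneg fun _ => sq_nonneg _
  linear_combination 2 * (hlower.trans hupper) +
    2 * mul_le_mul_of_nonneg_right (neg_abs_le l) hnonneg

theorem integral_sq_sub_le (hn : 0 ≤ n) :
    ∫ x, (u₁ (x, τ) - u₂ (x, τ)) ^ 2 ∂(muSpace Ω) ≤
      stabilityConst T l m K n ((muSpace Ω).real univ) *
        (∫ x, (u₁ (x, 0) - u₂ (x, 0)) ^ 2 ∂(muSpace Ω) +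
          coeffNorm Ω T (d₁.b - d₂.b) (d₁.c - d₂.c) (d₁.f - d₂.f) + β) := by
  have hgron := le_mul_exp_of_le_add_integral (a := 2 * |l|) (by positivity)
    (continuousOn_integral_slice hΩ.measurableSet hΩb
      ((h₁.continuousOn.sub h₂.continuousOn).pow 2))
    (fun t ht => integral_sq_sub_le_add_intervalIntegral hΩ hΩb hT hK h₁ h₂ ht hb hc hl hm hβ
      hg₁ hg₂ hg) τ hτ
  refine hgron.trans ?_
  set y₀ := ∫ x, (u₁ (x, 0) - u₂ (x, 0)) ^ 2 ∂(muSpace Ω)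
  set κ := coeffNorm Ω T (d₁.b - d₂.b) (d₁.c - d₂.c) (d₁.f - d₂.f)
  set q := 4 * K ^ 2 * ((muSpace Ω).real univ / 2 + n) / m
  have hy₀ : 0 ≤ y₀ := integral_nonneg fun _ => sq_nonneg _
  have hκ : 0 ≤ κ := coeffNorm_nonneg _ _ _
  have hq : 0 ≤ q := by positivity
  have hK2 : 0 ≤ 4 * K ^ 2 := by positivity
  have hsum : y₀ + 4 * K ^ 2 * κ + q * β ≤ (1 + 4 * K ^ 2 + q) * (y₀ + κ + β) := by
    linarith [mul_nonneg hK2 hy₀, mul_nonneg hK2 hβ, mul_nonneg hq hy₀, mul_nonneg hq hκ]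
  calc (y₀ + 4 * K ^ 2 * κ + q * β) * Real.exp (2 * |l| * τ)
      ≤ (1 + 4 * K ^ 2 + q) * (y₀ + κ + β) * Real.exp (2 * |l| * T) := by
        gcongr
        exact hτ.2
    _ = stabilityConst T l m K n ((muSpace Ω).real univ) * (y₀ + κ + β) := mul_right_comm _ _ _

end Stability

section Norms

variable {α E : Type*} [MeasurableSpace α] {μ : Measure α} [NormedAddCommGroup E] {f : α → E}

theorem ae_norm_le_toReal_eLpNorm_top (h : eLpNorm f ∞ μ ≠ ⊤) :
    ∀ᵐ x ∂μ, ‖f x‖ ≤ (eLpNorm f ∞ μ).toReal := by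
  filter_upwards [ae_le_eLpNormEssSup (f := f) (μ := μ)] with x hx
  rw [← toReal_enorm]
  exact ENNReal.toReal_mono h (by rwa [eLpNorm_exponent_top])

theorem eLpNorm_one_eq_ofReal_integral_norm (hf : Integrable f μ) :
    eLpNorm f 1 μ = ENNReal.ofReal (∫ x, ‖f x‖ ∂μ) := by
  rw [eLpNorm_one_eq_lintegral_enorm, ofReal_integral_norm_eq_lintegral_enorm hf]

theorem eLpNorm_two_sq_eq_ofReal_integral_sq {f : α → ℝ} (hf : MemLp f 2 μ) :
    eLpNorm f 2 μ ^ 2 = ENNReal.ofReal (∫ x, f x ^ 2 ∂μ) := by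
  rw [hf.eLpNorm_eq_integral_rpow_norm two_ne_zero ENNReal.ofNat_ne_top,
    ← ENNReal.ofReal_pow (by positivity), ← Real.rpow_mul_natCast (by positivity)]
  simp

theorem integral_norm_le_of_eLpNorm_two_le [IsFiniteMeasure μ] (hf : MemLp f 2 μ) {M : ℝ≥0}
    (h : eLpNorm f 2 μ ≤ M) : ∫ x, ‖f x‖ ∂μ ≤ M * √(μ.real univ) := by
  rw [← ENNReal.ofReal_le_ofReal_iff (by positivity),
    ← eLpNorm_one_eq_ofReal_integral_norm (hf.integrable one_le_two)]
  refine (eLpNorm_le_eLpNorm_mul_rpow_measure_univ one_le_two hf.1).trans ?_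
  have hexp : 1 / ENNReal.toReal 1 - 1 / ENNReal.toReal 2 = 1 / 2 := by norm_num
  rw [hexp, ENNReal.ofReal_mul M.coe_nonneg, ENNReal.ofReal_coe_nnreal, Real.sqrt_eq_rpow,
    ← ENNReal.ofReal_rpow_of_nonneg (by positivity) (by norm_num), ofReal_measureReal]
  gcongr

end Norms

section Data

variable {N : ℕ} {Ω : Set (Space N)} {T l m R S : ℝ} {d d₁ d₂ : Data N}
  {u u₁ u₂ w ut ut₁ ut₂ : Space N × ℝ → ℝ} {Du Du₁ Du₂ : Space N × ℝ → Space N}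

/-- The data `b`, `c`, `f` have total norm at most `M` in `L¹(Q_T)`, and `m ≤ g ≤ M`. -/
structure Data.IsL1Bounded {N : ℕ} (d : Data N) (Ω : Set (Space N)) (T m M : ℝ) : Prop where
  integrable_b : Integrable d.b (muCyl Ω T)
  integrable_c : Integrable d.c (muCyl Ω T)
  integrable_f : Integrable d.f (muCyl Ω T)
  coeffNorm_le : coeffNorm Ω T d.b d.c d.f ≤ M
  g_lower : ∀ᵐ z ∂(muCyl Ω T), m ≤ d.g z
  g_upper : ∀ᵐ z ∂(muCyl Ω T), d.g z ≤ M

theorem Data.Admissible.isL1Bounded {M : ℝ≥0} (h : d.Admissible Ω T l m)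
    (hM : d.BoundedBy Ω T M) (hΩb : Bornology.IsBounded Ω) :
    d.IsL1Bounded Ω T m (max M (3 * (M * √((muCyl Ω T).real univ)))) := by
  have := isFiniteMeasure_muCyl hΩb T
  have hb := integral_norm_le_of_eLpNorm_two_le h.b_memLp hM.b_le
  have hc := integral_norm_le_of_eLpNorm_two_le h.c_memLp hM.c_le
  have hf := integral_norm_le_of_eLpNorm_two_le h.f_memLp hM.f_le
  refine ⟨h.b_memLp.integrable one_le_two, h.c_memLp.integrable one_le_two,
    h.f_memLp.integrable one_le_two, le_max_of_le_right ?_, h.g_lower, ?_⟩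
  · unfold coeffNorm
    linarith
  · filter_upwards [ae_norm_le_toReal_eLpNorm_top h.g_W1Inf.memLp.2.ne] with z hz
    exact le_max_of_le_left ((Real.le_norm_self _).trans (hz.trans
      (ENNReal.toReal_le_coe_of_le_coe hM.g_le)))

theorem Data.IsL1Bounded.eLpNorm_sub_ne_top {M : ℝ} (h₁ : d₁.IsL1Bounded Ω T m M)
    (h₂ : d₂.IsL1Bounded Ω T m M) : eLpNorm (d₁.g - d₂.g) ∞ (muCyl Ω T) ≠ ⊤ := by
  rw [eLpNorm_exponent_top]
  refine (eLpNormEssSup_lt_top_of_ae_bound (C := M - m) ?_).ne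
  filter_upwards [h₁.g_lower, h₁.g_upper, h₂.g_lower, h₂.g_upper] with z l₁ r₁ l₂ r₂
  exact abs_sub_le_iff.2 ⟨sub_le_sub r₁ l₂, sub_le_sub r₂ l₁⟩

theorem IsSolutionWith.ae_ae_norm_grad_le {M : ℝ} (h : IsSolutionWith Ω T d u Du ut)
    (hΩ : IsOpen Ω) (hg : ∀ᵐ z ∂(muCyl Ω T), d.g z ≤ M) :
    ∀ᵐ t ∂(muTime T), ∀ᵐ x ∂(muSpace Ω), ‖Du (x, t)‖ ≤ M := by
  filter_upwards [h.grad, h.mem_convex, ae_ae_slice_time hg] with t hgrad ⟨G, hG, hGle⟩ hgt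
  filter_upwards [hgrad.ae_eq hΩ hG, hGle, hgt] with x hx hGx hgx
  rw [hx]
  exact hGx.trans hgx

/-- The bound for solutions and their gradients when `Ω` has radius `R` and `g ≤ M`. -/
def solutionBound (R M : ℝ) : ℝ := (2 * R + 1) * M + 1

theorem IsSolutionWith.isBoundedSolution {M : ℝ} (h : IsSolutionWith Ω T d u Du ut) (hN : 1 ≤ N)
    (hΩ : IsOpen Ω) (hT : 0 < T) (hR : 0 ≤ R) (hΩR : Ω ⊆ Metric.ball 0 R) (hM : 0 ≤ M)
    (hd : d.IsL1Bounded Ω T m M) : IsBoundedSolution Ω T (solutionBound R M) M d u Du ut where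
  toIsSolutionWith := h
  abs_le x hx t ht := by
    have hslice : ∀ᵐ t ∂(muTime T), ∀ᵐ x ∂(muSpace Ω), |u (x, t)| ≤ 2 * R * M := by
      filter_upwards [h.grad, h.ae_ae_norm_grad_le hΩ hd.g_upper] with t hgrad hle
      exact hgrad.ae_abs_le hN hR hΩ.measurableSet hΩR hM hle
    have := abs_le_of_ae_ae hΩ hT h.continuousOn hslice x hx t ht
    unfold solutionBound
    linarith
  norm_grad_le := by
    filter_upwards [ae_norm_le_of_ae_ae h.grad_memLp.1 (h.ae_ae_norm_grad_le hΩ hd.g_upper)]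
      with z hz
    unfold solutionBound
    linarith [mul_nonneg hR hM]
  integrable_b := hd.integrable_b
  integrable_c := hd.integrable_c
  integrable_f := hd.integrable_f
  coeffNorm_le := hd.coeffNorm_le

theorem ofReal_coeffNorm {b : Space N × ℝ → Space N} {c f : Space N × ℝ → ℝ}
    (hb : Integrable b (muCyl Ω T)) (hc : Integrable c (muCyl Ω T))
    (hf : Integrable f (muCyl Ω T)) :
    ENNReal.ofReal (coeffNorm Ω T b c f) =
      eLpNorm b 1 (muCyl Ω T) + eLpNorm c 1 (muCyl Ω T) + eLpNorm f 1 (muCyl Ω T) := by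
  rw [eLpNorm_one_eq_ofReal_integral_norm hb, eLpNorm_one_eq_ofReal_integral_norm hc,
    eLpNorm_one_eq_ofReal_integral_norm hf, ← ENNReal.ofReal_add (by positivity) (by positivity),
    ← ENNReal.ofReal_add (by positivity) (by positivity), coeffNorm]

theorem eLpNorm_slice_sq_eq (hΩ : MeasurableSet Ω) (hΩb : Bornology.IsBounded Ω)
    (hw : ContinuousOn w (closure Ω ×ˢ Icc 0 T)) {t : ℝ} (ht : t ∈ Icc 0 T) :
    eLpNorm (fun x => w (x, t)) 2 (muSpace Ω) ^ 2 =
      ENNReal.ofReal (∫ x, w (x, t) ^ 2 ∂(muSpace Ω)) :=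
  eLpNorm_two_sq_eq_ofReal_integral_sq ((memLp_two_iff_integrable_sq
    (aestronglyMeasurable_slice hΩ hw ht)).2
      (integrable_slice_of_continuousOn hΩ hΩb (hw.pow 2) ht))

theorem normLinfL2_sq_le (hΩ : MeasurableSet Ω) (hΩb : Bornology.IsBounded Ω)
    (hw : ContinuousOn w (closure Ω ×ˢ Icc 0 T))
    (h : ∀ t ∈ Icc 0 T, ∫ x, w (x, t) ^ 2 ∂(muSpace Ω) ≤ S) :
    normLinfL2 Ω T w ^ 2 ≤ ENNReal.ofReal S := by
  rw [← ENNReal.rpow_ofNat, ← ENNReal.le_rpow_inv_iff (by norm_num)]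
  refine essSup_le_of_ae_le _ ?_
  filter_upwards [self_mem_ae_restrict measurableSet_Ioo] with t ht
  rw [ENNReal.le_rpow_inv_iff (by norm_num), ENNReal.rpow_ofNat,
    eLpNorm_slice_sq_eq hΩ hΩb hw (Ioo_subset_Icc_self ht)]
  exact ENNReal.ofReal_le_ofReal (h t (Ioo_subset_Icc_self ht))

theorem IsSolutionWith.eLpNorm_initial_sub_sq_eq (h₁ : IsSolutionWith Ω T d₁ u₁ Du₁ ut₁)
    (h₂ : IsSolutionWith Ω T d₂ u₂ Du₂ ut₂) (hΩ : MeasurableSet Ω)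
    (hΩb : Bornology.IsBounded Ω) (hT : 0 ≤ T) :
    eLpNorm (d₁.u0 - d₂.u0) 2 (muSpace Ω) ^ 2 =
      ENNReal.ofReal (∫ x, (u₁ (x, 0) - u₂ (x, 0)) ^ 2 ∂(muSpace Ω)) := by
  refine Eq.trans ?_ (eLpNorm_slice_sq_eq hΩ hΩb (h₁.continuousOn.sub h₂.continuousOn)
    (left_mem_Icc.2 hT))
  congr 1
  refine eLpNorm_congr_ae ?_
  filter_upwards [h₁.initial, h₂.initial] with x hx₁ hx₂
  simp only [Pi.sub_apply, hx₁, hx₂]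

end Data

end GradVI

theorem theorem3p2_general {N : ℕ} (hN : 1 ≤ N) (Ω : Set (Space N)) (hΩ : IsOpen Ω)
    (hΩb : Bornology.IsBounded Ω) (T : ℝ) (hT : 0 < T) (l m : ℝ) (hm : 0 < m) (M : ℝ)
    (hM : 0 ≤ M) :
    ∃ C : ℝ, 0 < C ∧
      ∀ (d₁ d₂ : Data N) (u₁ u₂ : Space N × ℝ → ℝ),
        d₁.IsL1Bounded Ω T m M → d₂.IsL1Bounded Ω T m M →
        MemLp d₁.b 2 (muCyl Ω T) → MemLp d₁.c 2 (muCyl Ω T) → WeaklyCoercive Ω T l d₁.b d₁.c →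
        IsSolution Ω T d₁ u₁ → IsSolution Ω T d₂ u₂ →
        normLinfL2 Ω T (u₁ - u₂) ^ 2 ≤
          ENNReal.ofReal C *
            (eLpNorm (d₁.u0 - d₂.u0) 2 (muSpace Ω) ^ 2
              + eLpNorm (d₁.b - d₂.b) 1 (muCyl Ω T)
              + eLpNorm (d₁.c - d₂.c) 1 (muCyl Ω T)
              + eLpNorm (d₁.f - d₂.f) 1 (muCyl Ω T)
              + eLpNorm (d₁.g - d₂.g) ∞ (muCyl Ω T)) := by
  obtain ⟨R, hR, hΩR⟩ := hΩb.subset_ball_lt 0 0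
  have hC := stabilityConst_pos (T := T) (l := l) (K := solutionBound R M) hm hM
    (measureReal_nonneg (μ := muSpace Ω) (s := univ))
  refine ⟨_, hC, ?_⟩
  rintro d₁ d₂ u₁ u₂ hd₁ hd₂ hb hc hl ⟨Du₁, ut₁, h₁⟩ ⟨Du₂, ut₂, h₂⟩
  have hK : 1 ≤ solutionBound R M := le_add_of_nonneg_left (by positivity)
  have hg := hd₁.eLpNorm_sub_ne_top hd₂
  rw [add_assoc (eLpNorm (d₁.u0 - d₂.u0) 2 (muSpace Ω) ^ 2),
    add_assoc (eLpNorm (d₁.u0 - d₂.u0) 2 (muSpace Ω) ^ 2), ← ofReal_coeffNorm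
    (hd₁.integrable_b.sub hd₂.integrable_b) (hd₁.integrable_c.sub hd₂.integrable_c)
    (hd₁.integrable_f.sub hd₂.integrable_f),
    h₁.eLpNorm_initial_sub_sq_eq h₂ hΩ.measurableSet hΩb hT.le, ← ENNReal.ofReal_toReal hg,
    ← ENNReal.ofReal_add (by positivity) (coeffNorm_nonneg _ _ _),
    ← ENNReal.ofReal_add (add_nonneg (by positivity) (coeffNorm_nonneg _ _ _)) (by positivity),
    ← ENNReal.ofReal_mul hC.le]
  exact normLinfL2_sq_le hΩ.measurableSet hΩb (h₁.continuousOn.sub h₂.continuousOn) fun t ht =>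
    integral_sq_sub_le hΩ hΩb hT hK (h₁.isBoundedSolution hN hΩ hT hR.le hΩR hM hd₁)
      (h₂.isBoundedSolution hN hΩ hT hR.le hΩR hM hd₂) ht hb hc hl hm (by positivity)
      hd₁.g_lower hd₂.g_lower (ae_norm_le_toReal_eLpNorm_top hg) hM

theorem theorem3p2 {N : ℕ} (hN : 1 ≤ N) (Ω : Set (Space N)) (hΩ : IsOpen Ω)
    (hΩb : Bornology.IsBounded Ω) (T : ℝ) (hT : 0 < T) (l m : ℝ) (hm : 0 < m) (M : ℝ≥0) :
    ∃ C : ℝ, 0 < C ∧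
      ∀ (d₁ d₂ : Data N) (u₁ u₂ : Space N × ℝ → ℝ),
        d₁.Admissible Ω T l m → d₂.Admissible Ω T l m →
        d₁.BoundedBy Ω T M → d₂.BoundedBy Ω T M →
        IsSolution Ω T d₁ u₁ → IsSolution Ω T d₂ u₂ →
        normLinfL2 Ω T (u₁ - u₂) ^ 2 ≤
          ENNReal.ofReal C *
            (eLpNorm (d₁.u0 - d₂.u0) 2 (muSpace Ω) ^ 2
              + eLpNorm (d₁.b - d₂.b) 1 (muCyl Ω T)
              + eLpNorm (d₁.c - d₂.c) 1 (muCyl Ω T)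
              + eLpNorm (d₁.f - d₂.f) 1 (muCyl Ω T)
              + eLpNorm (d₁.g - d₂.g) ∞ (muCyl Ω T)) :=
  (theorem3p2_general hN Ω hΩ hΩb T hT l m hm _ (le_max_of_le_left M.2)).imp fun _ hC =>
    ⟨hC.1, fun d₁ d₂ u₁ u₂ ha₁ ha₂ hM₁ hM₂ => hC.2 d₁ d₂ u₁ u₂ (ha₁.isL1Bounded hM₁ hΩb)
      (ha₂.isL1Bounded hM₂ hΩb) ha₁.b_memLp ha₁.c_memLp ha₁.coercive⟩
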